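/- Let $m\ge 4$ with $m\neq 6$, let $\Gamma=\mathrm{Sym}(m)$, and let $\rho:\Gamma\to \mathrm{O}(n)$ be a faithful homomorphism which is irreducible as a real representation on $\mathbb{R}^n$. Let $\chi$ be the character of $\rho$, and suppose that $$\chi(x)\equiv n \pmod 8,\qquad \chi(xy)\equiv n \pmod 8$$ for all disjoint transpositions $x,y\in\Gamma$, and that $$M(z):=\frac1l\sum_{k=0}^{l-1}(-1)^k\chi(z^k)>0$$ for every odd permutation $z\in\Gamma$, where $l$ is the order of $z$. Let $\pi:\mathrm{Pin}(n)\to\mathrm{O}(n)$ be the standard two-fold covering, where $\mathrm{Pin}(n)$ is the group generated by the unit vectors in the Clifford algebra of $\mathbb{R}^n$ with $v\cdot v=-|v|^2$, and $\pi(g)(v)=\alpha(g)\,v\,g^{-1}$ with $\alpha$ the grading involution; let $\mathrm{Spin}(n)\subset\mathrm{Pin}(n)$ be the subgroup of even elements. For a group $G$ and homomorphisms $\phi_1,\phi_2:\Gamma\to G$, call $(G,\phi_1,\phi_2,\Gamma)$ admissible if for every $\gamma\in\Gamma$ there is $x\in G$ with $\phi_1(\gamma)=x\,\phi_2(\gamma)\,x^{-1}$,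 but there is no $g\in G$ with $g\,\phi_1(\Gamma)\,g^{-1}=\phi_2(\Gamma)$. Then: (a) If $n$ is odd, there are homomorphisms $\phi_1,\phi_2:\Gamma\to\mathrm{Spin}(n)$ with $\pi\circ\phi_1=\pi\circ\phi_2=\rho$ (in particular $\pi(\phi_i(\Gamma))=\rho(\Gamma)$) and $\phi_2(\gamma)=\mathrm{sgn}(\gamma)\,\phi_1(\gamma)$ for all $\gamma\in\Gamma$, such that $(\mathrm{Spin}(n),\phi_1,\phi_2,\Gamma)$ is admissible. (b) For every $n$, there are homomorphisms $\phi_1,\phi_2:\Gamma\to\mathrm{Pin}(n)$ with $\pi\circ\phi_1=\pi\circ\phi_2=\rho$ (in particular $\pi(\phi_i(\Gamma))=\rho(\Gamma)$) and $\phi_2(\gamma)=\mathrm{sgn}(\gamma)\,\phi_1(\gamma)$ for all $\gamma\in\Gamma$, such that $(\mathrm{Pin}(n),\phi_1,\phi_2,\Gamma)$ is admissible. -/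

import Mathlib

noncomputable section

/-! ### The compact groups `Pin(n)` and `Spin(n)` and the standard covering -/

/-- The negative definite form `v ↦ -(v₁² + ⋯ + vₙ²)` on `ℝⁿ`.  In its Clifford algebra the
standard basis satisfies `eᵢ² = -1` and `eᵢ eⱼ = - eⱼ eᵢ` for `i ≠ j`. -/
def negForm (n : ℕ) : QuadraticForm ℝ (Fin n → ℝ) :=
  QuadraticMap.weightedSumSquares ℝ (fun _ : Fin n => (-1 : ℝ))

/-- The group `Pin(n)`.  For the form `negForm n` every unit vector `v` satisfies
`star v * v = -v² = 1`, so this is the group of all products of unit vectors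
(for `n ≥ 1`). -/
abbrev PinG (n : ℕ) : Type := pinGroup (negForm n)

/-- The group `Spin(n)` of even elements of `Pin(n)`. -/
abbrev SpinG (n : ℕ) : Type := spinGroup (negForm n)

/-- The inclusion `Spin(n) ⊆ Pin(n)`. -/
def spinToPin (n : ℕ) : SpinG n →* PinG n :=
  Submonoid.inclusion inf_le_left

theorem negForm_apply (n : ℕ) (v : Fin n → ℝ) : negForm n v = -(v ⬝ᵥ v) := by
  simp [negForm, QuadraticMap.weightedSumSquares_apply, dotProduct]

theorem cliffordι_injective (n : ℕ) :
    Function.Injective (CliffordAlgebra.ι (negForm n)) := by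
  intro v w h
  have h' := congrArg (CliffordAlgebra.equivExterior (negForm n)) h
  simp only [CliffordAlgebra.equivExterior, CliffordAlgebra.changeFormEquiv_apply,
    CliffordAlgebra.changeForm_ι] at h'
  exact (ExteriorAlgebra.ι_leftInverse (R := ℝ) (M := Fin n → ℝ)).injective h'

theorem cliffordAlgebraMap_injective (n : ℕ) :
    Function.Injective (algebraMap ℝ (CliffordAlgebra (negForm n))) := by
  intro a b h
  have h' := congrArg (CliffordAlgebra.equivExterior (negForm n)) h
  simp only [CliffordAlgebra.equivExterior, CliffordAlgebra.changeFormEquiv_apply,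
    CliffordAlgebra.changeForm_algebraMap] at h'
  exact (ExteriorAlgebra.algebraMap_leftInverse (R := ℝ) (Fin n → ℝ)).injective h'

/-- The twisted adjoint action of `x ∈ Pin(n)` on the Clifford algebra, `a ↦ α(x) a x⁻¹`, where
`α` is the grading involution (`star x = x⁻¹` on `Pin(n)`). -/
def twistedAd {n : ℕ} (x : PinG n) :
    CliffordAlgebra (negForm n) →ₗ[ℝ] CliffordAlgebra (negForm n) :=
  LinearMap.mulLeft ℝ (CliffordAlgebra.involute (x : CliffordAlgebra (negForm n))) ∘ₗ
    LinearMap.mulRight ℝ (star (x : CliffordAlgebra (negForm n)))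

theorem twistedAd_apply {n : ℕ} (x : PinG n) (a : CliffordAlgebra (negForm n)) :
    twistedAd x a = CliffordAlgebra.involute (x : CliffordAlgebra (negForm n)) * a *
      star (x : CliffordAlgebra (negForm n)) := by
  simp [twistedAd, mul_assoc]

theorem twistedAd_one (n : ℕ) : twistedAd (1 : PinG n) = LinearMap.id := by
  ext1 a
  simp [twistedAd_apply]

theorem twistedAd_mul {n : ℕ} (x y : PinG n) :
    twistedAd (x * y) = twistedAd x ∘ₗ twistedAd y := by
  ext1 a
  simp [twistedAd_apply, mul_assoc]

theorem twistedAd_ι_mem {n : ℕ} (x : PinG n) (v : Fin n → ℝ) :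
    twistedAd x (CliffordAlgebra.ι (negForm n) v) ∈
      LinearMap.range (CliffordAlgebra.ι (negForm n)) := by
  rw [twistedAd_apply]
  exact pinGroup.involute_act_ι_mem_range_ι (x := pinGroup.toUnits x) x.2 v

/-- `ℝⁿ` as the space of vectors inside its Clifford algebra. -/
def vectorEquiv (n : ℕ) :
    (Fin n → ℝ) ≃ₗ[ℝ] LinearMap.range (CliffordAlgebra.ι (negForm n)) :=
  LinearEquiv.ofInjective (CliffordAlgebra.ι (negForm n)) (cliffordι_injective n)

/-- The linear map `ℝⁿ → ℝⁿ` given by `v ↦ α(x) v x⁻¹`, for `x ∈ Pin(n)`. -/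
def pinLin {n : ℕ} (x : PinG n) : (Fin n → ℝ) →ₗ[ℝ] (Fin n → ℝ) :=
  (vectorEquiv n).symm.toLinearMap ∘ₗ
    LinearMap.codRestrict _ (twistedAd x ∘ₗ CliffordAlgebra.ι (negForm n)) (twistedAd_ι_mem x)

theorem ι_pinLin {n : ℕ} (x : PinG n) (v : Fin n → ℝ) :
    CliffordAlgebra.ι (negForm n) (pinLin x v) = twistedAd x (CliffordAlgebra.ι (negForm n) v) := by
  have h : ((vectorEquiv n (pinLin x v) : LinearMap.range (CliffordAlgebra.ι (negForm n))) :
      CliffordAlgebra (negForm n)) = twistedAd x (CliffordAlgebra.ι (negForm n) v) := by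
    simp [pinLin]
  exact h

theorem pinLin_one (n : ℕ) : pinLin (1 : PinG n) = LinearMap.id := by
  refine LinearMap.ext fun v => cliffordι_injective n ?_
  rw [ι_pinLin, twistedAd_one]
  rfl

theorem pinLin_mul {n : ℕ} (x y : PinG n) : pinLin (x * y) = pinLin x ∘ₗ pinLin y := by
  refine LinearMap.ext fun v => cliffordι_injective n ?_
  rw [ι_pinLin, twistedAd_mul, LinearMap.comp_apply, LinearMap.comp_apply, ι_pinLin, ι_pinLin]

theorem pinLin_form {n : ℕ} (x : PinG n) (v : Fin n → ℝ) :
    negForm n (pinLin x v) = negForm n v := by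
  apply cliffordAlgebraMap_injective n
  have h1 : star (x : CliffordAlgebra (negForm n)) * (x : CliffordAlgebra (negForm n)) = 1 :=
    pinGroup.coe_star_mul_self x
  have h2 : (x : CliffordAlgebra (negForm n)) * star (x : CliffordAlgebra (negForm n)) = 1 :=
    pinGroup.coe_mul_star_self x
  have h3 := congrArg CliffordAlgebra.involute h2
  rw [map_mul, map_one] at h3
  have h4 := ι_pinLin x v
  rw [twistedAd_apply] at h4
  have h5 := congrArg CliffordAlgebra.involute h4
  simp only [map_mul, CliffordAlgebra.involute_ι, CliffordAlgebra.involute_involute] at h5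
  rw [← CliffordAlgebra.ι_sq_scalar, ← CliffordAlgebra.ι_sq_scalar]
  set a := CliffordAlgebra.ι (negForm n) v
  set b := CliffordAlgebra.ι (negForm n) (pinLin x v)
  set X : CliffordAlgebra (negForm n) := (x : CliffordAlgebra (negForm n))
  have h6 : b = X * a * CliffordAlgebra.involute (star X) := by
    have := congrArg Neg.neg h5
    simpa using this
  have h7 : a * a = algebraMap ℝ _ (negForm n v) := CliffordAlgebra.ι_sq_scalar _ v
  calc b * b = (CliffordAlgebra.involute X * a * star X) *
        (X * a * CliffordAlgebra.involute (star X)) := by rw [← h6, ← h4]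
    _ = CliffordAlgebra.involute X * (a * (star X * X) * a) *
        CliffordAlgebra.involute (star X) := by simp only [mul_assoc]
    _ = CliffordAlgebra.involute X * (a * a) * CliffordAlgebra.involute (star X) := by
        rw [h1, mul_one]
    _ = a * a := by
        rw [h7, ← Algebra.commutes, mul_assoc, h3, mul_one]

theorem pinLin_toMatrix_mem {n : ℕ} (x : PinG n) :
    LinearMap.toMatrix' (pinLin x) ∈ Matrix.orthogonalGroup (Fin n) ℝ := by
  have hq : ∀ v : Fin n → ℝ, pinLin x v ⬝ᵥ pinLin x v = v ⬝ᵥ v := fun v => by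
    have := pinLin_form x v
    rw [negForm_apply, negForm_apply] at this
    linarith
  have hb : ∀ v w : Fin n → ℝ, pinLin x v ⬝ᵥ pinLin x w = v ⬝ᵥ w := fun v w => by
    have h := hq (v + w)
    rw [map_add, add_dotProduct, dotProduct_add, dotProduct_add, add_dotProduct, dotProduct_add,
      dotProduct_add, hq, hq, dotProduct_comm (pinLin x w) (pinLin x v),
      dotProduct_comm w v] at h
    linarith
  rw [Matrix.mem_orthogonalGroup_iff']
  ext i j
  have h := hb (Pi.single i 1) (Pi.single j 1)
  simp only [dotProduct, Matrix.mul_apply, Matrix.transpose_apply, LinearMap.toMatrix'_apply,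
    Matrix.one_apply] at h ⊢
  rw [h]
  simp [Pi.single_apply, eq_comm]

/-- The standard covering homomorphism `π : Pin(n) → O(n)`: `π(x)` is the matrix of
`v ↦ α(x) v x⁻¹`, so that a unit vector is sent to the reflection in its orthogonal
hyperplane. -/
def pinCover (n : ℕ) : PinG n →* Matrix.orthogonalGroup (Fin n) ℝ where
  toFun x := ⟨LinearMap.toMatrix' (pinLin x), pinLin_toMatrix_mem x⟩
  map_one' := Subtype.ext (by
    change LinearMap.toMatrix' (pinLin (1 : PinG n)) = 1
    rw [pinLin_one, LinearMap.toMatrix'_id])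
  map_mul' x y := Subtype.ext (by
    change LinearMap.toMatrix' (pinLin (x * y)) =
      LinearMap.toMatrix' (pinLin x) * LinearMap.toMatrix' (pinLin y)
    rw [pinLin_mul, LinearMap.toMatrix'_comp])

/-- The restriction `Spin(n) → O(n)` of the standard covering; its image is `SO(n)`
(for `n ≥ 1`). -/
def spinCover (n : ℕ) : SpinG n →* Matrix.orthogonalGroup (Fin n) ℝ :=
  (pinCover n).comp (spinToPin n)

/-! ### Element-wise conjugate homomorphisms -/

/-- Two homomorphisms `φ₁, φ₂ : Γ → G` are element-wise conjugate. -/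
def ElementwiseConj {Γ G : Type*} [Group Γ] [Group G] (φ₁ φ₂ : Γ →* G) : Prop :=
  ∀ γ : Γ, ∃ x : G, φ₁ γ = x * φ₂ γ * x⁻¹

/-- The quadruple `(G, φ₁, φ₂, Γ)` is admissible: `φ₁` and `φ₂` are element-wise conjugate,
but no inner automorphism of `G` maps the subgroup `φ₁(Γ)` onto the subgroup `φ₂(Γ)`. -/
def Admissible {Γ G : Type*} [Group Γ] [Group G] (φ₁ φ₂ : Γ →* G) : Prop :=
  ElementwiseConj φ₁ φ₂ ∧
    ¬ ∃ g : G, φ₁.range.map (MulAut.conj g).toMonoidHom = φ₂.range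

/-! ### Orthogonal representations -/

/-- The linear representation on `ℝⁿ` given by a homomorphism into `O(n)`. -/
def orthRep {Γ : Type*} [Group Γ] {n : ℕ} (ρ : Γ →* Matrix.orthogonalGroup (Fin n) ℝ) :
    Representation ℝ Γ (Fin n → ℝ) where
  toFun γ := Matrix.toLin' (ρ γ : Matrix (Fin n) (Fin n) ℝ)
  map_one' := by simp [Module.End.one_eq_id]
  map_mul' γ δ := by simp [Matrix.toLin'_mul, Module.End.mul_eq_comp]

/-- `M(z) = (1/l) ∑_{k=0}^{l-1} (-1)^k χ(z^k)`, where `l` is the order of `z` and `χ` is the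
character of `ρ`. -/
def multNegOne {Γ : Type*} [Group Γ] {n : ℕ} (ρ : Γ →* Matrix.orthogonalGroup (Fin n) ℝ)
    (z : Γ) : ℝ :=
  (1 / (orderOf z : ℝ)) *
    ∑ k ∈ Finset.range (orderOf z), (-1 : ℝ) ^ k * (orthRep ρ).character (z ^ k)

end

noncomputable section

/-! Everything turns on the sign `-1` in the kernel of the covering.

Lifting: an orthogonal involution whose trace is congruent to `n` modulo 8 has a `-1`-eigenspace of
dimension divisible by 4, and the product of an orthonormal basis of it is an even lift of order
dividing two (`exists_spin_lift_of_involution`). Hence lifts of transpositions are involutions, and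
lifts of disjoint transpositions commute; this is enough to lift `ρ` (`exists_lift_of_swap_lifts`).
Twisting the lift by the sign character gives the second homomorphism.

Element-wise conjugacy: the two lifts agree on even permutations. For an odd `γ`, positivity of
`multNegOne ρ γ` yields a unit vector `v` with `ρ γ v = -v` (`exists_neg_eigenvector`). Such a `v`
anticommutes with the even element `φ₁ γ`, so conjugation by `v` changes its sign. To stay in Spin
when `n` is odd, `v` is multiplied by the volume element, which commutes with even elements.

No global conjugacy: a conjugation of one image into the other induces an automorphism of the
symmetric group, which is inner (`exists_eq_conj_of_injective`). After correction by an element of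
the image, some `y` intertwines `φ₁` and `φ₂`, so its image in `O(n)` commutes with `ρ`. An element
of this commutant is `-1` or a square in it (`eq_neg_one_or_exists_sq`), which forces `y` to commute
with the lifts (`coe_mul_comm_of_commute`). At a transposition `τ` this reads `φ₁ τ = -φ₁ τ`, which
is absurd. -/

/-! ### Unit vectors and reflections -/

open CliffordAlgebra in
theorem ι_mul_ι_add_swap_negForm {n : ℕ} (v w : Fin n → ℝ) :
    ι (negForm n) v * ι (negForm n) w + ι (negForm n) w * ι (negForm n) v =
      algebraMap ℝ _ (-2 * (v ⬝ᵥ w)) := by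
  rw [ι_mul_ι_add_swap]
  congr 1
  simp only [QuadraticMap.polar, negForm_apply, add_dotProduct, dotProduct_add, dotProduct_comm w v]
  ring

theorem ι_mul_self_negForm {n : ℕ} {v : Fin n → ℝ} (hv : v ⬝ᵥ v = 1) :
    CliffordAlgebra.ι (negForm n) v * CliffordAlgebra.ι (negForm n) v = -1 := by
  rw [CliffordAlgebra.ι_sq_scalar, negForm_apply, hv, map_neg, map_one]

theorem star_ι_negForm {n : ℕ} (v : Fin n → ℝ) :
    star (CliffordAlgebra.ι (negForm n) v) = -CliffordAlgebra.ι (negForm n) v := by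
  simp [CliffordAlgebra.star_def]

theorem ι_mem_pinGroup {n : ℕ} {v : Fin n → ℝ} (hv : v ⬝ᵥ v = 1) :
    CliffordAlgebra.ι (negForm n) v ∈ pinGroup (negForm n) := by
  have h := ι_mul_self_negForm hv
  have hs := star_ι_negForm v
  refine ⟨⟨⟨_, -CliffordAlgebra.ι (negForm n) v, ?_, ?_⟩, Subgroup.subset_closure ⟨v, rfl⟩, rfl⟩,
    ?_⟩
  · rw [mul_neg, h, neg_neg]
  · rw [neg_mul, h, neg_neg]
  · rw [SetLike.mem_coe, Unitary.mem_iff, hs, mul_neg, neg_mul, h, neg_neg]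
    exact ⟨rfl, rfl⟩

/-- A unit vector, as an element of `Pin(n)`. -/
def unitPin {n : ℕ} (v : Fin n → ℝ) (hv : v ⬝ᵥ v = 1) : PinG n :=
  ⟨CliffordAlgebra.ι (negForm n) v, ι_mem_pinGroup hv⟩

theorem pinLin_unitPin {n : ℕ} (v : Fin n → ℝ) (hv : v ⬝ᵥ v = 1) (w : Fin n → ℝ) :
    pinLin (unitPin v hv) w = w - (2 * (v ⬝ᵥ w)) • v := by
  apply cliffordι_injective
  rw [ι_pinLin, twistedAd_apply]
  simp only [unitPin, CliffordAlgebra.involute_ι, star_ι_negForm]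
  have h1 := ι_mul_self_negForm hv
  have h2 := ι_mul_ι_add_swap_negForm v w
  rw [Algebra.algebraMap_eq_smul_one] at h2
  rw [map_sub, map_smul]
  set a := CliffordAlgebra.ι (negForm n) v
  set b := CliffordAlgebra.ι (negForm n) w
  have h3 : a * b = (-2 * (v ⬝ᵥ w)) • 1 - b * a := by rw [← h2]; abel
  calc -a * b * -a = a * b * a := by noncomm_ring
    _ = ((-2 * (v ⬝ᵥ w)) • 1 - b * a) * a := by rw [h3]
    _ = (-2 * (v ⬝ᵥ w)) • a - b * (a * a) := by
        rw [sub_mul, smul_mul_assoc, one_mul, mul_assoc]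
    _ = _ := by rw [h1, neg_mul, neg_smul]; noncomm_ring

/-! ### The kernel of the covering -/

section kernel

open CliffordAlgebra

/-- Both sides are antiderivations that agree on vectors. This turns twisted commutation with all
vectors into the vanishing of all contractions. -/
theorem contractLeft_eq_twisted_commutator {n : ℕ} (v : Fin n → ℝ) (d : Module.Dual ℝ (Fin n → ℝ))
    (hd : ∀ w, d w = -2 * (v ⬝ᵥ w)) (x : CliffordAlgebra (negForm n)) :
    contractLeft d x = ι (negForm n) v * x - involute x * ι (negForm n) v := by
  induction x using CliffordAlgebra.left_induction with
  | algebraMap r => simp [Algebra.commutes]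
  | add x y hx hy => rw [map_add, hx, hy, map_add]; noncomm_ring
  | ι_mul x m hx =>
    have h := ι_mul_ι_add_swap_negForm v m
    rw [contractLeft_ι_mul, hx, map_mul, involute_ι, Algebra.smul_def, hd, ← h]
    noncomm_ring

/-- The operator removing from an element of the exterior algebra the part divisible by `eᵢ`. -/
def extStrip {n : ℕ} (i : Fin n) :
    CliffordAlgebra (0 : QuadraticForm ℝ (Fin n → ℝ)) →ₗ[ℝ]
      CliffordAlgebra (0 : QuadraticForm ℝ (Fin n → ℝ)) :=
  LinearMap.id - LinearMap.mulLeft ℝ (ι 0 (Pi.single i 1)) ∘ₗ contractLeft (LinearMap.proj i)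

theorem extStrip_apply {n : ℕ} (i : Fin n) (y : CliffordAlgebra (0 : QuadraticForm ℝ (Fin n → ℝ))) :
    extStrip i y = y - ι 0 (Pi.single i 1) * contractLeft (LinearMap.proj i) y := rfl

theorem ext_ι_mul_swap {n : ℕ} (v w : Fin n → ℝ) :
    ι (0 : QuadraticForm ℝ (Fin n → ℝ)) v * ι 0 w = -(ι 0 w * ι 0 v) := by
  rw [eq_neg_iff_add_eq_zero, ι_mul_ι_add_swap]
  simp [QuadraticMap.polar]

theorem extStrip_ι_mul_self {n : ℕ} (i : Fin n)
    (y : CliffordAlgebra (0 : QuadraticForm ℝ (Fin n → ℝ))) :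
    extStrip i (ι 0 (Pi.single i 1) * y) = 0 := by
  have h : ι (0 : QuadraticForm ℝ (Fin n → ℝ)) (Pi.single i 1) * ι 0 (Pi.single i 1) = 0 := by
    simp [ι_sq_scalar]
  rw [extStrip_apply, contractLeft_ι_mul, mul_sub, ← mul_assoc (ι 0 _) (ι 0 _), h]
  simp

theorem extStrip_ι_mul_of_ne {n : ℕ} {i j : Fin n} (hij : i ≠ j)
    (y : CliffordAlgebra (0 : QuadraticForm ℝ (Fin n → ℝ))) :
    extStrip i (ι 0 (Pi.single j 1) * y) = ι 0 (Pi.single j 1) * extStrip i y := by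
  rw [extStrip_apply, contractLeft_ι_mul, extStrip_apply]
  have : (LinearMap.proj i : Module.Dual ℝ (Fin n → ℝ)) (Pi.single j 1) = 0 := by
    simp [hij]
  rw [this, zero_smul, zero_sub, mul_neg, sub_neg_eq_add, mul_sub, ← mul_assoc, ← mul_assoc,
    ext_ι_mul_swap (Pi.single i 1)]
  noncomm_ring

/-- The composition of the operators `extStrip i` over a list of indices. -/
def extStripList {n : ℕ} (l : List (Fin n)) :
    CliffordAlgebra (0 : QuadraticForm ℝ (Fin n → ℝ)) →ₗ[ℝ]
      CliffordAlgebra (0 : QuadraticForm ℝ (Fin n → ℝ)) :=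
  l.foldr (fun i f => f ∘ₗ extStrip i) LinearMap.id

theorem extStripList_cons {n : ℕ} (i : Fin n) (l : List (Fin n))
    (y : CliffordAlgebra (0 : QuadraticForm ℝ (Fin n → ℝ))) :
    extStripList (i :: l) y = extStripList l (extStrip i y) := rfl

/-- The operators with index other than `j` pass through `eⱼ`, and the one with index `j` kills
whatever starts with `eⱼ`. -/
theorem extStripList_ι_mul {n : ℕ} (l : List (Fin n)) {j : Fin n} (hj : j ∈ l)
    (y : CliffordAlgebra (0 : QuadraticForm ℝ (Fin n → ℝ))) :
    extStripList l (ι 0 (Pi.single j 1) * y) = 0 := by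
  induction l generalizing y with
  | nil => simp at hj
  | cons i l ih =>
    rw [extStripList_cons]
    by_cases hij : i = j
    · rw [hij, extStrip_ι_mul_self, map_zero]
    · rw [extStrip_ι_mul_of_ne hij]
      exact ih ((List.mem_cons.1 hj).resolve_left (Ne.symm hij)) _

theorem extStripList_eq_self {n : ℕ} (l : List (Fin n))
    (y : CliffordAlgebra (0 : QuadraticForm ℝ (Fin n → ℝ)))
    (hy : ∀ d : Module.Dual ℝ (Fin n → ℝ), contractLeft d y = 0) :
    extStripList l y = y := by
  induction l with
  | nil => rfl
  | cons i l ih => rw [extStripList_cons, extStrip_apply, hy, mul_zero, sub_zero, ih]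

/-- Stripping all basis directions sends every element to a scalar, yet fixes an element with no
nonzero contraction. -/
theorem mem_range_algebraMap_of_contractLeft_eq_zero {n : ℕ}
    (y : CliffordAlgebra (0 : QuadraticForm ℝ (Fin n → ℝ)))
    (hy : ∀ d : Module.Dual ℝ (Fin n → ℝ), contractLeft d y = 0) :
    ∃ c : ℝ, y = algebraMap ℝ _ c := by
  have key : ∀ x : CliffordAlgebra (0 : QuadraticForm ℝ (Fin n → ℝ)),
      ∃ c : ℝ, extStripList (List.finRange n) x = algebraMap ℝ _ c := by
    intro x
    induction x using CliffordAlgebra.left_induction with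
    | algebraMap r =>
      exact ⟨r, extStripList_eq_self _ _ fun d => contractLeft_algebraMap _ _ _⟩
    | add x y hx hy =>
      obtain ⟨a, ha⟩ := hx
      obtain ⟨b, hb⟩ := hy
      exact ⟨a + b, by rw [map_add, ha, hb, map_add]⟩
    | ι_mul x m _ =>
      refine ⟨0, ?_⟩
      have hm : m = ∑ j, m j • (Pi.single j 1 : Fin n → ℝ) := by
        simpa using (pi_eq_sum_univ' m)
      rw [hm, map_sum, Finset.sum_mul, map_sum, map_zero]
      refine Finset.sum_eq_zero fun j _ => ?_
      rw [map_smul, smul_mul_assoc, map_smul, extStripList_ι_mul _ (List.mem_finRange j), smul_zero]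
  obtain ⟨c, hc⟩ := key y
  exact ⟨c, by rw [← hc, extStripList_eq_self _ _ hy]⟩

theorem eq_algebraMap_of_twisted_commute {n : ℕ} (x : CliffordAlgebra (negForm n))
    (hx : ∀ v, involute x * ι (negForm n) v = ι (negForm n) v * x) :
    ∃ c : ℝ, x = algebraMap ℝ _ c := by
  have hd : ∀ d : Module.Dual ℝ (Fin n → ℝ), contractLeft d x = 0 := by
    intro d
    -- The factor `-(1/2)` inverts the `-2` in the polar form, so every functional is represented by
    -- some vector.
    rw [contractLeft_eq_twisted_commutator (fun i => -(1 / 2) * d (Pi.single i 1)) d ?_ x, hx,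
      sub_self]
    intro w
    conv_lhs => rw [pi_eq_sum_univ' w]
    simp only [map_sum, map_smul, smul_eq_mul, dotProduct, Finset.mul_sum]
    refine Finset.sum_congr rfl fun i _ => ?_
    ring
  obtain ⟨c, hc⟩ := mem_range_algebraMap_of_contractLeft_eq_zero (equivExterior (negForm n) x)
    fun d => by
      simp only [equivExterior, changeFormEquiv_apply]
      rw [← changeForm_contractLeft, hd, map_zero]
  refine ⟨c, (equivExterior (negForm n)).injective ?_⟩
  rw [hc]
  simp only [equivExterior, changeFormEquiv_apply, changeForm_algebraMap]

theorem involute_mul_ι {n : ℕ} (x : PinG n) (v : Fin n → ℝ) :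
    involute (x : CliffordAlgebra (negForm n)) * ι (negForm n) v =
      ι (negForm n) (pinLin x v) * x := by
  rw [ι_pinLin, twistedAd_apply, mul_assoc _ (star _), pinGroup.coe_star_mul_self, mul_one]

theorem coe_eq_one_or_neg_one_of_pinLin {n : ℕ} (x : PinG n) (hx : ∀ v, pinLin x v = v) :
    (x : CliffordAlgebra (negForm n)) = 1 ∨ (x : CliffordAlgebra (negForm n)) = -1 := by
  obtain ⟨c, hc⟩ := eq_algebraMap_of_twisted_commute (x : CliffordAlgebra (negForm n)) fun v => by
    rw [involute_mul_ι, hx]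
  have h1 := pinGroup.coe_mul_star_self x
  rw [pinGroup.coe_star, hc, CliffordAlgebra.star_algebraMap, ← map_mul,
    ← map_one (algebraMap ℝ _)] at h1
  have h2 := cliffordAlgebraMap_injective n h1
  rcases mul_self_eq_one_iff.1 h2 with h | h
  · left; rw [hc, h, map_one]
  · right; rw [hc, h, map_neg, map_one]

end kernel

theorem pinCover_apply {n : ℕ} (x : PinG n) :
    (pinCover n x : Matrix (Fin n) (Fin n) ℝ) = LinearMap.toMatrix' (pinLin x) := rfl

theorem pinCover_mulVec {n : ℕ} (x : PinG n) (v : Fin n → ℝ) :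
    Matrix.mulVec (pinCover n x : Matrix (Fin n) (Fin n) ℝ) v = pinLin x v := by
  rw [pinCover_apply, ← Matrix.toLin'_apply, Matrix.toLin'_toMatrix']

/-- The kernel consists of scalars fixed by `star`, so `x * star x = 1` leaves only `c² = 1`. -/
theorem coe_eq_or_neg_of_pinCover_eq {n : ℕ} {x y : PinG n} (h : pinCover n x = pinCover n y) :
    (x : CliffordAlgebra (negForm n)) = y ∨ (x : CliffordAlgebra (negForm n)) = -y := by
  have h1 : pinCover n (x * y⁻¹) = 1 := by rw [map_mul, map_inv, h, mul_inv_cancel]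
  have h2 := coe_eq_one_or_neg_one_of_pinLin (x * y⁻¹) fun v => by
    rw [← pinCover_mulVec, h1]; simp
  have h3 : (x : CliffordAlgebra (negForm n)) =
      ((x * y⁻¹ : PinG n) : CliffordAlgebra (negForm n)) * y := by
    rw [← Submonoid.coe_mul, inv_mul_cancel_right]
  rcases h2 with h2 | h2
  · left; rw [h3, h2, one_mul]
  · right; rw [h3, h2, neg_one_mul]

/-! ### Surjectivity of the covering -/

section surjectivity

theorem euclidean_inner_eq_dotProduct {n : ℕ} (v w : EuclideanSpace ℝ (Fin n)) :
    inner ℝ v w = v.ofLp ⬝ᵥ w.ofLp := by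
  simp [PiLp.inner_apply, dotProduct, mul_comm]

theorem exists_pinLin_eq_reflection {n : ℕ} (v : EuclideanSpace ℝ (Fin n)) :
    ∃ x : PinG n, ∀ w : EuclideanSpace ℝ (Fin n),
      pinLin x w.ofLp = (Submodule.reflection (Submodule.span ℝ {v})ᗮ w).ofLp := by
  by_cases hv : v = 0
  · refine ⟨1, fun w => ?_⟩
    rw [pinLin_one, Submodule.reflection_orthogonal_apply, Submodule.reflection_singleton_apply, hv]
    simp
  · have hpos : 0 < ‖v‖ := norm_pos_iff.2 hv
    have hnn : v.ofLp ⬝ᵥ v.ofLp = ‖v‖ ^ 2 := by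
      rw [← euclidean_inner_eq_dotProduct, real_inner_self_eq_norm_sq]
    refine ⟨unitPin (‖v‖⁻¹ • v.ofLp) ?_, fun w => ?_⟩
    · rw [smul_dotProduct, dotProduct_smul, hnn, smul_eq_mul, smul_eq_mul]
      field_simp
    · rw [pinLin_unitPin, Submodule.reflection_orthogonal_apply,
        Submodule.reflection_singleton_apply, euclidean_inner_eq_dotProduct]
      ext i
      simp only [smul_dotProduct, smul_eq_mul, Pi.sub_apply, Pi.smul_apply, PiLp.neg_apply,
        PiLp.sub_apply, PiLp.smul_apply, nsmul_eq_mul, RCLike.ofReal_real_eq_id, id_eq]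
      field_simp
      push_cast
      ring

theorem exists_pinLin_eq_isometry {n : ℕ}
    (φ : EuclideanSpace ℝ (Fin n) ≃ₗᵢ[ℝ] EuclideanSpace ℝ (Fin n)) :
    ∃ x : PinG n, ∀ w : EuclideanSpace ℝ (Fin n), pinLin x w.ofLp = (φ w).ofLp := by
  obtain ⟨l, -, rfl⟩ := φ.reflections_generate_dim
  induction l with
  | nil => exact ⟨1, fun w => by rw [pinLin_one]; rfl⟩
  | cons v l ih =>
    obtain ⟨x, hx⟩ := exists_pinLin_eq_reflection v
    obtain ⟨y, hy⟩ := ih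
    refine ⟨x * y, fun w => ?_⟩
    rw [pinLin_mul, LinearMap.comp_apply, hy, hx, List.map_cons, List.prod_cons]
    rfl

/-- This is Cartan–Dieudonné: an isometry is a product of reflections, and each reflection is
covered by a unit vector. -/
theorem exists_pinCover_eq {n : ℕ} (A : Matrix.orthogonalGroup (Fin n) ℝ) :
    ∃ x : PinG n, pinCover n x = A := by
  have hA : (A : Matrix (Fin n) (Fin n) ℝ).transpose * A = 1 :=
    (Matrix.mem_orthogonalGroup_iff' _ _).1 A.2
  let f : EuclideanSpace ℝ (Fin n) →ₗᵢ[ℝ] EuclideanSpace ℝ (Fin n) :=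
    { toLinearMap := Matrix.toEuclideanLin (A : Matrix (Fin n) (Fin n) ℝ)
      norm_map' := fun v => by
        rw [← sq_eq_sq₀ (norm_nonneg _) (norm_nonneg _), ← real_inner_self_eq_norm_sq,
          ← real_inner_self_eq_norm_sq, euclidean_inner_eq_dotProduct,
          euclidean_inner_eq_dotProduct]
        change Matrix.mulVec (A : Matrix (Fin n) (Fin n) ℝ) v.ofLp ⬝ᵥ
          Matrix.mulVec (A : Matrix (Fin n) (Fin n) ℝ) v.ofLp = _
        rw [Matrix.dotProduct_mulVec, ← Matrix.mulVec_transpose, Matrix.mulVec_mulVec, hA,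
          Matrix.one_mulVec] }
  obtain ⟨x, hx⟩ := exists_pinLin_eq_isometry (f.toLinearIsometryEquiv rfl)
  refine ⟨x, Subtype.ext (Matrix.ext_of_mulVec_single fun i => ?_)⟩
  rw [pinCover_mulVec]
  exact hx (WithLp.toLp 2 (Pi.single i 1))

end surjectivity

/-! ### Products of orthonormal vectors -/

section orthonormal

open CliffordAlgebra

variable {n : ℕ}

/-- The product in `Pin(n)` of the unit vectors `u i`, for `i` in a list. -/
def orthoProd (u : Fin n → Fin n → ℝ) (hu : ∀ i, u i ⬝ᵥ u i = 1) (l : List (Fin n)) : PinG n :=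
  (l.map fun i => unitPin (u i) (hu i)).prod

theorem orthoProd_cons (u : Fin n → Fin n → ℝ) (hu : ∀ i, u i ⬝ᵥ u i = 1) (i : Fin n)
    (l : List (Fin n)) : orthoProd u hu (i :: l) = unitPin (u i) (hu i) * orthoProd u hu l := by
  simp [orthoProd]

theorem pinLin_orthoProd (u : Fin n → Fin n → ℝ) (hu : ∀ i, u i ⬝ᵥ u i = 1)
    (ho : ∀ i j, i ≠ j → u i ⬝ᵥ u j = 0) (l : List (Fin n)) (hl : l.Nodup) (j : Fin n) :
    pinLin (orthoProd u hu l) (u j) = if j ∈ l then -u j else u j := by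
  induction l with
  | nil => simp [orthoProd, pinLin_one]
  | cons i l ih =>
    rw [orthoProd_cons, pinLin_mul, LinearMap.comp_apply, ih hl.of_cons]
    by_cases hij : j = i
    · subst hij
      rw [if_neg (List.nodup_cons.1 hl).1, if_pos (by simp), pinLin_unitPin, hu, two_mul, add_smul]
      simp
    · by_cases hj : j ∈ l
      · rw [if_pos hj, if_pos (by simp [hj]), map_neg, pinLin_unitPin, ho i j (Ne.symm hij)]
        simp
      · rw [if_neg hj, if_neg (by simp [hj, hij]), pinLin_unitPin, ho i j (Ne.symm hij)]
        simp

theorem coe_orthoProd_mul_ι (u : Fin n → Fin n → ℝ) (hu : ∀ i, u i ⬝ᵥ u i = 1)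
    (ho : ∀ i j, i ≠ j → u i ⬝ᵥ u j = 0) (l : List (Fin n)) (j : Fin n) (hj : j ∉ l) :
    (orthoProd u hu l : CliffordAlgebra (negForm n)) * ι (negForm n) (u j) =
      (-1) ^ l.length * (ι (negForm n) (u j) * orthoProd u hu l) := by
  induction l with
  | nil => simp [orthoProd]
  | cons i l ih =>
    rw [List.mem_cons, not_or] at hj
    have h1 := ι_mul_ι_add_swap_negForm (u i) (u j)
    rw [ho i j (Ne.symm hj.1), mul_zero, map_zero] at h1
    have h2 := eq_neg_of_add_eq_zero_left h1
    rw [orthoProd_cons, Submonoid.coe_mul, mul_assoc, ih hj.2, List.length_cons, pow_succ]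
    change ι (negForm n) (u i) * _ = _ * (_ * (ι (negForm n) (u i) * _))
    rw [← mul_assoc, ← ((Commute.neg_one_left _).pow_left _).eq, mul_assoc, ← mul_assoc (ι _ (u i)),
      h2]
    noncomm_ring

/-- Moving the first vector past the `l` others costs `(-1) ^ l`, and its own square costs one more
sign. The exponents therefore add up as `1 + 2 + ⋯`. -/
theorem coe_orthoProd_mul_self (u : Fin n → Fin n → ℝ) (hu : ∀ i, u i ⬝ᵥ u i = 1)
    (ho : ∀ i j, i ≠ j → u i ⬝ᵥ u j = 0) (l : List (Fin n)) (hl : l.Nodup) :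
    (orthoProd u hu l : CliffordAlgebra (negForm n)) * orthoProd u hu l =
      (-1) ^ (∑ k ∈ Finset.range (l.length + 1), k) := by
  induction l with
  | nil => simp [orthoProd]
  | cons i l ih =>
    rw [List.length_cons, Finset.sum_range_succ, pow_add, ← ih hl.of_cons, orthoProd_cons,
      Submonoid.coe_mul]
    change ι (negForm n) (u i) * _ * (ι (negForm n) (u i) * _) = _
    rw [mul_assoc, ← mul_assoc _ (ι _ _), coe_orthoProd_mul_ι u hu ho l i (List.nodup_cons.1 hl).1,
      ← mul_assoc, ← mul_assoc, ← ((Commute.neg_one_left _).pow_left _).eq,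
      mul_assoc _ (ι _ _), ← mul_assoc (ι _ _) (ι _ _), ι_mul_self_negForm (hu i), pow_succ,
      ((Commute.neg_one_left _).pow_left _).eq]
    rw [← ((Commute.neg_one_left _).pow_left _).eq]
    have := ((Commute.neg_one_left ((orthoProd u hu l : CliffordAlgebra (negForm n)) *
      orthoProd u hu l)).pow_left l.length).eq
    rw [mul_neg_one, mul_neg, ← this]
    noncomm_ring

theorem coe_orthoProd_mem_evenOdd (u : Fin n → Fin n → ℝ) (hu : ∀ i, u i ⬝ᵥ u i = 1)
    (l : List (Fin n)) :
    (orthoProd u hu l : CliffordAlgebra (negForm n)) ∈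
      evenOdd (negForm n) (l.length : ZMod 2) := by
  induction l with
  | nil => simpa [orthoProd] using SetLike.one_mem_graded (evenOdd (negForm n))
  | cons i l ih =>
    rw [orthoProd_cons, Submonoid.coe_mul, List.length_cons, Nat.cast_succ, add_comm]
    exact SetLike.mul_mem_graded (ι_mem_evenOdd_one _ _) ih

end orthonormal

/-! ### Spin lifts of involutions -/

theorem spinCover_apply {n : ℕ} (x : SpinG n) :
    spinCover n x = pinCover n (spinToPin n x) := rfl

theorem coe_spinToPin {n : ℕ} (x : SpinG n) :
    (spinToPin n x : CliffordAlgebra (negForm n)) = x := rfl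

theorem spinToPin_injective (n : ℕ) : Function.Injective (spinToPin n) := fun _ _ h =>
  Subtype.ext (congrArg (fun z : PinG n => (z : CliffordAlgebra (negForm n))) h)

/-- An orthogonal involution is symmetric, hence orthogonally diagonalizable with eigenvalues `±1`.
The trace is `n - 2s`, where `s` counts the eigenvalues `-1`, so `s = 4k`. The product of the
corresponding eigenvectors is even and squares to `(-1) ^ (2k(4k+1)) = 1`. -/
theorem exists_spin_lift_of_involution {n : ℕ} (A : Matrix.orthogonalGroup (Fin n) ℝ)
    (hA : A * A = 1) (a : ℤ)
    (ht : (A : Matrix (Fin n) (Fin n) ℝ).trace = (n : ℝ) + 8 * (a : ℝ)) :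
    ∃ x : SpinG n, spinCover n x = A ∧ x * x = 1 := by
  have hA2 : (A : Matrix (Fin n) (Fin n) ℝ) * (A : Matrix (Fin n) (Fin n) ℝ) = 1 :=
    congrArg Subtype.val hA
  have hA1 : (A : Matrix (Fin n) (Fin n) ℝ).transpose * A = 1 :=
    (Matrix.mem_orthogonalGroup_iff' _ _).1 A.2
  have hsym : (A : Matrix (Fin n) (Fin n) ℝ).transpose = A := by
    calc (A : Matrix (Fin n) (Fin n) ℝ).transpose = (A : Matrix (Fin n) (Fin n) ℝ).transpose *
          ((A : Matrix (Fin n) (Fin n) ℝ) * (A : Matrix (Fin n) (Fin n) ℝ)) := by rw [hA2, mul_one]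
      _ = A := by rw [← mul_assoc, hA1, one_mul]
  have hH : (A : Matrix (Fin n) (Fin n) ℝ).IsHermitian := by
    rw [Matrix.IsHermitian, Matrix.conjTranspose_eq_transpose_of_trivial, hsym]
  let u : Fin n → Fin n → ℝ := fun i => (hH.eigenvectorBasis i).ofLp
  have huu : ∀ i j, u i ⬝ᵥ u j = if i = j then 1 else 0 := fun i j => by
    rw [← euclidean_inner_eq_dotProduct]
    exact orthonormal_iff_ite.1 hH.eigenvectorBasis.orthonormal i j
  have hu : ∀ i, u i ⬝ᵥ u i = 1 := fun i => by simp [huu]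
  have ho : ∀ i j, i ≠ j → u i ⬝ᵥ u j = 0 := fun i j h => by simp [huu, h]
  have hmul : ∀ j, Matrix.mulVec (A : Matrix (Fin n) (Fin n) ℝ) (u j) = hH.eigenvalues j • u j :=
    fun j => hH.mulVec_eigenvectorBasis j
  have hev : ∀ j, hH.eigenvalues j = 1 ∨ hH.eigenvalues j = -1 := by
    intro j
    have h1 : Matrix.mulVec ((A : Matrix (Fin n) (Fin n) ℝ) * (A : Matrix (Fin n) (Fin n) ℝ)) (u j) =
        u j := by
      rw [hA2, Matrix.one_mulVec]
    rw [← Matrix.mulVec_mulVec, hmul, Matrix.mulVec_smul, hmul, smul_smul] at h1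
    have h2 := congrArg (fun w => u j ⬝ᵥ w) h1
    simp only [dotProduct_smul, hu, smul_eq_mul, mul_one] at h2
    exact mul_self_eq_one_iff.1 h2
  let s : Finset (Fin n) := Finset.univ.filter fun j => hH.eigenvalues j = -1
  have hcard : (s.card : ℤ) = -4 * a := by
    have h1 : (A : Matrix (Fin n) (Fin n) ℝ).trace = ∑ j, hH.eigenvalues j := by
      simpa using hH.trace_eq_sum_eigenvalues
    have h2 : ∀ j, hH.eigenvalues j = 1 - 2 * (if hH.eigenvalues j = -1 then 1 else 0) := by
      intro j
      rcases hev j with h | h <;> rw [h] <;> norm_num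
    rw [Finset.sum_congr rfl fun j _ => h2 j, Finset.sum_sub_distrib, ← Finset.mul_sum,
      Finset.sum_boole, ht] at h1
    simp only [Finset.sum_const, Finset.card_univ, Fintype.card_fin, nsmul_eq_mul, mul_one] at h1
    have h3 : (s.card : ℝ) = -4 * a := by
      change _ = (n : ℝ) - 2 * (s.card : ℝ) at h1
      linarith
    exact_mod_cast h3
  obtain ⟨k, hk⟩ : ∃ k : ℕ, s.card = 4 * k := ⟨s.card / 4, by omega⟩
  have hlen : s.toList.length = 4 * k := by rw [Finset.length_toList, hk]
  have heven : (orthoProd u hu s.toList : CliffordAlgebra (negForm n)) ∈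
      CliffordAlgebra.even (negForm n) := by
    have h := coe_orthoProd_mem_evenOdd u hu s.toList
    rw [hlen] at h
    have h0 : ((4 * k : ℕ) : ZMod 2) = 0 := by
      rw [ZMod.natCast_eq_zero_iff]
      omega
    rw [h0] at h
    exact h
  refine ⟨⟨_, (orthoProd u hu s.toList).2, heven⟩, ?_, ?_⟩
  · change pinCover n (orthoProd u hu s.toList) = A
    refine Subtype.ext ?_
    rw [pinCover_apply, ← LinearEquiv.eq_symm_apply]
    refine (hH.eigenvectorBasis.toBasis.map (WithLp.linearEquiv 2 ℝ (Fin n → ℝ))).ext fun j => ?_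
    have h1 : (hH.eigenvectorBasis.toBasis.map (WithLp.linearEquiv 2 ℝ (Fin n → ℝ))) j = u j := by
      simp [u]
    rw [h1, pinLin_orthoProd u hu ho _ s.nodup_toList, LinearMap.toMatrix'_symm,
      Matrix.toLin'_apply, hmul]
    rcases hev j with h | h
    · have hj : j ∉ s.toList := by simp [s, h]; norm_num
      rw [if_neg hj, h, one_smul]
    · have hj : j ∈ s.toList := by simp [s, h]
      rw [if_pos hj, h, neg_one_smul]
  · refine Subtype.ext ?_
    change (orthoProd u hu s.toList : CliffordAlgebra (negForm n)) * orthoProd u hu s.toList = 1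
    rw [coe_orthoProd_mul_self u hu ho _ s.nodup_toList, hlen]
    refine Even.neg_one_pow ?_
    have h := Finset.sum_range_id_mul_two (4 * k + 1)
    refine ⟨(4 * k + 1) * k, ?_⟩
    rw [Nat.add_sub_cancel] at h
    nlinarith

/-! ### Homomorphisms out of symmetric groups -/

section symmetric

open Equiv Equiv.Perm

theorem Equiv.Perm.conj_swap_eq {α : Type*} [DecidableEq α] (γ : Perm α) (i j : α) :
    γ * swap i j * γ⁻¹ = swap (γ i) (γ j) := by
  rw [mul_swap_eq_swap_mul, mul_inv_cancel_right]

/-- A family `a i j` of involutions of a group satisfying the relations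
`a i j * a k l * a i j = a (σ k) (σ l)` with `σ = (i j)` is the image of the family of
transpositions under a homomorphism. -/
theorem exists_perm_hom_of_swap_relations {G : Type*} [Group G] (α : Type*) [Fintype α] :
    ∀ [DecidableEq α] (a : α → α → G) (_ : ∀ i, a i i = 1) (_ : ∀ i j, a i j = a j i)
      (_ : ∀ i j, a i j * a i j = 1)
      (_ : ∀ i j k l, a i j * a k l * a i j = a (swap i j k) (swap i j l)),
      ∃ φ : Perm α →* G, ∀ i j, φ (swap i j) = a i j := by
  refine Fintype.induction_empty_option (P := fun α _ => ∀ [DecidableEq α] (a : α → α → G)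
      (_ : ∀ i, a i i = 1) (_ : ∀ i j, a i j = a j i)
      (_ : ∀ i j, a i j * a i j = 1)
      (_ : ∀ i j k l, a i j * a k l * a i j = a (swap i j k) (swap i j l)),
      ∃ φ : Perm α →* G, ∀ i j, φ (swap i j) = a i j) ?_ ?_ ?_ α
  · intro α β _ e ih _ a h1 h2 h3 h4
    classical
    obtain ⟨φ, hφ⟩ := ih (fun i j => a (e i) (e j)) (fun i => h1 _) (fun i j => h2 _ _)
      (fun i j => h3 _ _) fun i j k l => by
        rw [h4]; congr 1 <;> simp [swap_apply_def, apply_ite e]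
    refine ⟨φ.comp e.permCongrHom.symm.toMonoidHom, fun i j => ?_⟩
    have : e.permCongrHom.symm (swap i j) = swap (e.symm i) (e.symm j) := by
      ext x
      simp [permCongrHom, Equiv.permCongr_def, swap_apply_def,
        Equiv.eq_symm_apply]
    change φ (e.permCongrHom.symm (swap i j)) = _
    rw [this, hφ]
    simp
  · intro _ a _ _ _ _
    exact ⟨1, fun i => i.elim⟩
  · intro α _ ih inst a h1 h2 h3 h4
    classical
    obtain rfl : inst = Option.instDecidableEq := Subsingleton.elim _ _
    obtain ⟨φ, hφ⟩ := ih (fun i j => a (some i) (some j)) (fun i => h1 _) (fun i j => h2 _ _)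
      (fun i j => h3 _ _) fun i j k l => by
        rw [h4, ← optionCongr_swap, optionCongr_apply, optionCongr_apply]; rfl
    have hopt : ∀ σ τ : Perm α, (σ * τ).optionCongr = σ.optionCongr * τ.optionCongr := by
      intro σ τ
      ext x
      cases x <;> simp
    -- Each permutation is uniquely `swap none p * σ.optionCongr` with `p` the image of `none`, so
    -- this formula is forced. Multiplicativity then reduces to left multiplication by one
    -- transposition.
    let F : Perm (Option α) → G := fun γ => a none (γ none) * φ (removeNone γ)
    have hF : ∀ p (σ : Perm α), F (swap none p * σ.optionCongr) = a none p * φ σ := by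
      intro p σ
      have h := decomposeOption.apply_symm_apply (p, σ)
      simp only [decomposeOption_symm_apply, decomposeOption_apply, Prod.mk.injEq] at h
      change a none _ * φ _ = _
      rw [h.1, h.2]
    have hcomm : ∀ i j k l, a i j * a k l = a (swap i j k) (swap i j l) * a i j := by
      intro i j k l
      rw [← h4, mul_assoc, h3, mul_one]
    have hsome : ∀ i j : α, ∀ γ, F (swap (some i) (some j) * γ) = a (some i) (some j) * F γ := by
      intro i j γ
      obtain ⟨⟨p, σ⟩, rfl⟩ := decomposeOption.symm.surjective γ
      simp only [decomposeOption_symm_apply]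
      rw [hF, ← mul_assoc, ← mul_assoc, hcomm]
      have h5 : swap (some i) (some j) * swap none p =
          swap none (swap (some i) (some j) p) * swap (some i) (some j) := by
        rw [mul_swap_eq_swap_mul, swap_apply_of_ne_of_ne (by simp) (by simp)]
      rw [h5, mul_assoc, ← optionCongr_swap, ← hopt, hF, map_mul, hφ,
        optionCongr_swap, swap_apply_of_ne_of_ne (a := some i) (b := some j) (x := none)
          (by simp) (by simp), mul_assoc]
    have hnone : ∀ j : α, ∀ γ, F (swap none (some j) * γ) = a none (some j) * F γ := by
      intro j γ
      obtain ⟨⟨p, σ⟩, rfl⟩ := decomposeOption.symm.surjective γ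
      simp only [decomposeOption_symm_apply]
      rw [hF]
      rcases p with _ | p
      · rw [swap_self]
        change F (_ * (1 * _)) = _
        rw [one_mul, hF, h1, one_mul]
      · by_cases hpj : p = j
        · subst hpj
          rw [← mul_assoc, ← mul_assoc, swap_mul_self, h3, one_mul, one_mul]
          have := hF none σ
          rw [swap_self, h1, one_mul] at this
          exact this
        · have h5 : swap none (some j) * swap none (some p) =
              swap none (some p) * swap (some p) (some j) := by
            rw [mul_swap_eq_swap_mul (swap none (some p))]
            simp [swap_apply_of_ne_of_ne, Ne.symm hpj]
          have h6 : a none (some j) * a none (some p) = a none (some p) * a (some p) (some j) := by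
            have := h4 none (some p) none (some j)
            rw [swap_apply_left, swap_apply_of_ne_of_ne (by simp) (by simpa using Ne.symm hpj)]
              at this
            rw [← this, ← mul_assoc, ← mul_assoc, h3, one_mul]
          rw [← mul_assoc, ← mul_assoc, h5, h6, mul_assoc, ← optionCongr_swap, ← hopt,
            hF, map_mul, hφ, mul_assoc]
    have hswap : ∀ i j γ, F (swap i j * γ) = a i j * F γ := by
      intro i j γ
      rcases i with _ | i <;> rcases j with _ | j
      · rw [h1, swap_self, one_mul]; exact congrArg F (one_mul γ)
      · exact hnone _ _
      · rw [swap_comm, h2]; exact hnone _ _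
      · exact hsome _ _ _
    have hone : F 1 = 1 := by
      have := hF none 1
      rw [swap_self, h1, one_mul, map_one, optionCongr_one] at this
      exact this
    have hmul : ∀ γ δ, F (γ * δ) = F γ * F δ := by
      intro γ δ
      induction γ using swap_induction_on with
      | one => rw [one_mul, hone, one_mul]
      | swap_mul f x y _ ih => rw [mul_assoc, hswap, ih, hswap x y f, ← mul_assoc]
    refine ⟨⟨⟨F, hone⟩, hmul⟩, fun i j => ?_⟩
    have := hswap i j 1
    rw [mul_one, hone, mul_one] at this
    exact this

/-- A lifting criterion through a central extension by a group with at most two elements: it is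
enough that lifts of transpositions are involutions and lifts of disjoint transpositions
commute. -/
theorem exists_lift_of_swap_lifts {α G O : Type*} [Fintype α] [DecidableEq α] [Nontrivial α]
    [Group G] [Group O] (p : G →* O) (ρ : Perm α →* O) (z : G)
    (hz : ∀ x, z * x = x * z) (hker : ∀ x y, p x = p y → x = y ∨ x = z * y)
    (hlift : ∀ i j, i ≠ j → ∃ x, p x = ρ (swap i j))
    (hsq : ∀ i j x, i ≠ j → p x = ρ (swap i j) → x * x = 1)
    (hcomm : ∀ i j k l x y, i ≠ j → k ≠ l → i ≠ k → i ≠ l → j ≠ k → j ≠ l →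
      p x = ρ (swap i j) → p y = ρ (swap k l) → x * y = y * x) :
    ∃ φ : Perm α →* G, p.comp φ = ρ := by
  have hall : ∀ γ, ∃ x, p x = ρ γ := by
    intro γ
    induction γ using swap_induction_on with
    | one => exact ⟨1, by rw [map_one, map_one]⟩
    | swap_mul f i j hij ih =>
      obtain ⟨x, hx⟩ := hlift i j hij
      obtain ⟨y, hy⟩ := ih
      exact ⟨x * y, by rw [map_mul, map_mul, hx, hy]⟩
  choose L hL using hall
  obtain ⟨i₀, i₁, h01⟩ := exists_pair_ne α
  let t := swap i₀ i₁
  -- `c γ` is the candidate lift of `γ * t * γ⁻¹`. Centrality of `z` makes it independent of the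
  -- lift chosen for `γ`; it remains to see that it depends only on the transposition `γ * t * γ⁻¹`.
  let c : Perm α → G := fun γ => L γ * L t * (L γ)⁻¹
  have hc : ∀ γ x, p x = ρ γ → x * L t * x⁻¹ = c γ := by
    intro γ x hx
    rcases hker x (L γ) (by rw [hx, hL]) with h | h
    · rw [h]
    · change _ = L γ * L t * (L γ)⁻¹
      have hz' : z * (L t * (L γ)⁻¹) * z⁻¹ = L t * (L γ)⁻¹ := by rw [hz, mul_inv_cancel_right]
      rw [h, hz]
      calc L γ * z * L t * (L γ * z)⁻¹ = L γ * z * L t * (z * L γ)⁻¹ := by rw [hz]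
        _ = L γ * (z * (L t * (L γ)⁻¹) * z⁻¹) := by group
        _ = _ := by rw [hz', mul_assoc]
  have hcmul : ∀ γ δ x, p x = ρ γ → c (γ * δ) = x * c δ * x⁻¹ := by
    intro γ δ x hx
    rw [← hc (γ * δ) (x * L δ) (by rw [map_mul, map_mul, hx, hL])]
    change _ = x * (L δ * L t * (L δ)⁻¹) * x⁻¹
    group
  have hc1 : c 1 = L t := by
    rw [← hc 1 1 (by rw [map_one, map_one])]; group
  have hfix : ∀ γ : Perm α, γ i₀ = i₀ → γ i₁ = i₁ → c γ = L t := by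
    intro γ h0 h1
    have hiff : ∀ x, γ x = x → ∀ y, y ≠ x ↔ γ y ≠ x := fun x hx y => by
      rw [not_iff_not]
      exact ⟨fun h => by rw [h, hx], fun h => γ.injective (by rw [h, hx])⟩
    -- Permutations fixing `i₀` and `i₁` are products of transpositions disjoint from `t`, whose
    -- lifts commute with `L t`.
    have key : ∀ σ : Perm {x : α // x ≠ i₀ ∧ x ≠ i₁}, c (ofSubtype σ) = L t := by
      intro σ
      induction σ using swap_induction_on with
      | one => rw [map_one, hc1]
      | swap_mul f x y hxy ih =>
        have hxy' : (x : α) ≠ y := fun h => hxy (Subtype.ext h)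
        rw [map_mul, ofSubtype_swap_eq, hcmul _ _ _ (hL _), ih, mul_inv_eq_iff_eq_mul]
        exact hcomm x y i₀ i₁ _ _ hxy' h01 x.2.1 x.2.2 y.2.1 y.2.2 (hL _) (hL _)
    have := key (γ.subtypePerm fun x => and_congr (hiff i₀ h0 x).symm (hiff i₁ h1 x).symm)
    rwa [ofSubtype_subtypePerm] at this
    intro x hx
    exact ⟨fun h => hx (by rw [h, h0]), fun h => hx (by rw [h, h1])⟩
  have hstab : ∀ γ : Perm α, γ * t * γ⁻¹ = t → c γ = L t := by
    intro γ hγ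
    rw [conj_swap_eq] at hγ
    have h2 : t (γ i₀) = γ i₁ := by rw [← hγ, swap_apply_left]
    have h3 : γ i₀ = i₀ ∨ γ i₀ = i₁ := by
      by_contra h
      rw [not_or] at h
      rw [swap_apply_of_ne_of_ne h.1 h.2] at h2
      exact h01 (γ.injective h2)
    rcases h3 with h3 | h3
    · rw [h3, swap_apply_left] at h2
      exact hfix γ h3 h2.symm
    · rw [h3, swap_apply_right] at h2
      -- If `γ` exchanges `i₀` and `i₁`, then `t * γ` fixes both, and conjugation by `L t` does not
      -- move `L t`.
      have h4 := hfix (t * γ) (by rw [mul_apply, h3, swap_apply_right])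
        (by rw [mul_apply, ← h2, swap_apply_left])
      rw [hcmul t γ _ (hL t), mul_inv_eq_iff_eq_mul, mul_right_inj] at h4
      exact h4
  have hwd : ∀ γ δ : Perm α, γ * t * γ⁻¹ = δ * t * δ⁻¹ → c γ = c δ := by
    intro γ δ h
    have h5 := hstab (δ⁻¹ * γ) (by
      calc δ⁻¹ * γ * t * (δ⁻¹ * γ)⁻¹ = δ⁻¹ * (γ * t * γ⁻¹) * δ := by group
        _ = t := by rw [h]; group)
    have h6 := hcmul δ (δ⁻¹ * γ) _ (hL δ)
    rwa [mul_inv_cancel_left, h5] at h6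
  have hconj : ∀ i j, i ≠ j → ∃ γ : Perm α, γ * t * γ⁻¹ = swap i j := fun i j hij =>
    isConj_iff.1 (isConj_swap h01 hij)
  have hb : ∀ i j, ∃ b : G, (i = j → b = 1) ∧
      (∀ γ : Perm α, i ≠ j → γ * t * γ⁻¹ = swap i j → b = c γ) := by
    intro i j
    by_cases hij : i = j
    · exact ⟨1, fun _ => rfl, fun _ h => absurd hij h⟩
    · obtain ⟨γ, hγ⟩ := hconj i j hij
      exact ⟨c γ, fun h => absurd h hij, fun δ _ hδ => hwd _ _ (by rw [hγ, hδ])⟩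
  choose a ha1 ha using hb
  have hpa : ∀ i j, p (a i j) = ρ (swap i j) := by
    intro i j
    by_cases hij : i = j
    · rw [ha1 i j hij, hij, swap_self, map_one]
      exact (map_one ρ).symm
    · obtain ⟨γ, hγ⟩ := hconj i j hij
      rw [ha i j γ hij hγ, ← hγ]
      simp only [c, map_mul, map_inv, hL]
  have hasq : ∀ i j, a i j * a i j = 1 := by
    intro i j
    by_cases hij : i = j
    · rw [ha1 i j hij, one_mul]
    · exact hsq i j _ hij (hpa i j)
  obtain ⟨φ, hφ⟩ := exists_perm_hom_of_swap_relations α a (fun i => ha1 i i rfl) (fun i j => by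
      by_cases hij : i = j
      · rw [hij]
      · obtain ⟨γ, hγ⟩ := hconj i j hij
        rw [ha i j γ hij hγ, ha j i γ (Ne.symm hij) (by rw [hγ, swap_comm])]) hasq
    (fun i j k l => by
      by_cases hkl : k = l
      · rw [ha1 k l hkl, ha1 _ _ (congrArg _ hkl), mul_one, hasq]
      · obtain ⟨γ, hγ⟩ := hconj k l hkl
        rw [ha k l γ hkl hγ, ha _ _ (swap i j * γ) (fun h => hkl ((swap i j).injective h)) ?_,
          hcmul (swap i j) γ _ (hpa i j), inv_eq_of_mul_eq_one_left (hasq i j)]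
        rw [← conj_swap_eq, ← hγ]
        group)
  refine ⟨φ, MonoidHom.ext fun γ => ?_⟩
  induction γ using swap_induction_on with
  | one => rw [map_one, map_one]
  | swap_mul f i j _ ih => rw [map_mul, map_mul, ih, MonoidHom.comp_apply, hφ, hpa]

end symmetric

/-! ### Automorphisms of symmetric groups -/

section automorphisms

open Equiv Equiv.Perm

variable {α : Type*} [DecidableEq α]

theorem Equiv.Perm.swap_mul_swap_pow_six [Fintype α] (i j k l : α) :
    (swap i j * swap k l) ^ 6 = 1 := by
  have h3 : ∀ a b c : α, (swap a b * swap a c) ^ 6 = 1 := by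
    intro a b c
    by_cases hab : a = b
    · rw [hab, swap_self]
      change (1 * swap b c) ^ 6 = 1
      rw [one_mul, pow_mul (swap b c) 2 3, pow_two, swap_mul_self, one_pow]
    by_cases hac : a = c
    · rw [hac, swap_self]
      change (swap c b * 1) ^ 6 = 1
      rw [mul_one, pow_mul (swap c b) 2 3, pow_two, swap_mul_self, one_pow]
    by_cases hbc : b = c
    · rw [hbc, swap_mul_self, one_pow]
    have h := (isThreeCycle_swap_mul_swap_same hab hac hbc).orderOf
    rw [pow_mul _ 3 2, ← h, pow_orderOf_eq_one, one_pow]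
  by_cases hik : i = k
  · rw [hik]; exact h3 _ _ _
  by_cases hil : i = l
  · rw [hil, swap_comm k l]; exact h3 _ _ _
  by_cases hjk : j = k
  · rw [hjk, swap_comm i k]; exact h3 _ _ _
  by_cases hjl : j = l
  · rw [hjl, swap_comm i l, swap_comm k l]; exact h3 _ _ _
  have hc : Commute (swap i j) (swap k l) := by
    have := mul_swap_eq_swap_mul (swap i j) k l
    rwa [swap_apply_of_ne_of_ne (Ne.symm hik) (Ne.symm hjk),
      swap_apply_of_ne_of_ne (Ne.symm hil) (Ne.symm hjl)] at this
  rw [hc.mul_pow, pow_mul (swap i j) 2 3, pow_mul (swap k l) 2 3, pow_two, pow_two, swap_mul_self,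
    swap_mul_self, one_pow, one_mul]

/-- The conjugate is chosen to act as `(a e)(b c)` and fix `d`, so the product contains the 5-cycle
`a → e → b → d → c → a`. Its sixth power sends `a` to `e`. -/
theorem Equiv.Perm.exists_conj_of_two_cycles_of_fixed (σ : Perm α) (a b c d e : α)
    (hn : [a, b, c, d, e].Nodup) (ha : σ a = b) (hb : σ b = a) (hc : σ c = d) (hd : σ d = c)
    (he : σ e = e) : ∃ δ : Perm α, (σ * (δ * σ * δ⁻¹)) ^ 6 ≠ 1 := by
  simp only [List.nodup_cons, List.mem_cons, List.not_mem_nil, not_or, or_false,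
    not_false_eq_true, List.nodup_nil, and_true] at hn
  obtain ⟨⟨hab, hac, had, hae⟩, ⟨hbc, hbd, hbe⟩, ⟨hcd, hce⟩, hde⟩ := hn
  let δ := swap b d * swap b e
  have da : δ a = a := by simp [δ, swap_apply_def, hab, had, hae]
  have db : δ b = e := by simp [δ, swap_apply_def, Ne.symm hbe, Ne.symm hde]
  have dc : δ c = c := by simp [δ, swap_apply_def, Ne.symm hbc, hcd, hce]
  have dd : δ d = b := by simp [δ, swap_apply_def, Ne.symm hbd, hde]
  have de : δ e = d := by simp [δ]
  have ia : δ⁻¹ a = a := by rw [inv_eq_iff_eq, da]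
  have ib : δ⁻¹ b = d := by rw [inv_eq_iff_eq, dd]
  have ic : δ⁻¹ c = c := by rw [inv_eq_iff_eq, dc]
  have id : δ⁻¹ d = e := by rw [inv_eq_iff_eq, de]
  have ie : δ⁻¹ e = b := by rw [inv_eq_iff_eq, db]
  refine ⟨δ, fun h => hae ?_⟩
  have h6 := congrArg (fun τ : Perm α => τ a) h
  simp only [pow_succ, pow_zero, one_mul, mul_apply, one_apply, ia, ib, ic, id, ie, da, db, dc, dd,
    de, ha, hb, hc, hd, he] at h6
  exact h6.symm

/-- The conjugate is chosen to act as `(a h)(b c)(d e)(f g)`, so the product contains the 4-cycle `a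
→ g → e → c → a`. Its sixth power sends `a` to `e`. -/
theorem Equiv.Perm.exists_conj_of_four_two_cycles (σ : Perm α) (a b c d e f g h : α)
    (hn : [a, b, c, d, e, f, g, h].Nodup) (ha : σ a = b) (hb : σ b = a) (hc : σ c = d)
    (hd : σ d = c) (he : σ e = f) (hf : σ f = e) (hg : σ g = h) (hh : σ h = g) :
    ∃ δ : Perm α, (σ * (δ * σ * δ⁻¹)) ^ 6 ≠ 1 := by
  simp only [List.nodup_cons, List.mem_cons, List.not_mem_nil, not_or, or_false,
    not_false_eq_true, List.nodup_nil, and_true] at hn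
  obtain ⟨⟨hab, hac, had, hae, haf, hag, hah⟩, ⟨hbc, hbd, hbe, hbf, hbg, hbh⟩,
    ⟨hcd, hce, hcf, hcg, hch⟩, ⟨hde, hdf, hdg, hdh⟩, ⟨hef, heg, heh⟩, ⟨hfg, hfh⟩, hgh⟩ := hn
  let δ := swap b d * swap b f * swap b h
  have da : δ a = a := by simp [δ, swap_apply_def, hab, had, haf, hah]
  have db : δ b = h := by
    simp [δ, swap_apply_def, Ne.symm hbh, Ne.symm hdh, Ne.symm hfh]
  have dc : δ c = c := by simp [δ, swap_apply_def, Ne.symm hbc, hcd, hcf, hch]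
  have dd : δ d = b := by simp [δ, swap_apply_def, Ne.symm hbd, hdf, hdh]
  have de : δ e = e := by simp [δ, swap_apply_def, Ne.symm hbe, Ne.symm hde, hef, heh]
  have df : δ f = d := by simp [δ, swap_apply_def, Ne.symm hbf, hfh]
  have dg : δ g = g := by
    simp [δ, swap_apply_def, Ne.symm hbg, Ne.symm hdg, Ne.symm hfg, hgh]
  have dh : δ h = f := by simp [δ, swap_apply_def, Ne.symm hbf, Ne.symm hdf]
  have ia : δ⁻¹ a = a := by rw [inv_eq_iff_eq, da]
  have ic : δ⁻¹ c = c := by rw [inv_eq_iff_eq, dc]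
  have ie : δ⁻¹ e = e := by rw [inv_eq_iff_eq, de]
  have ig : δ⁻¹ g = g := by rw [inv_eq_iff_eq, dg]
  refine ⟨δ, fun h' => hae ?_⟩
  have h6 := congrArg (fun τ : Perm α => τ a) h'
  simp only [pow_succ, pow_zero, one_mul, mul_apply, one_apply, ia, ic, ie, ig, db, dd, df, dh,
    ha, hb, hc, hd, he, hf, hg, hh] at h6
  exact h6.symm

theorem Equiv.Perm.IsSwap.eq_swap_apply {σ : Perm α} (hσ : σ.IsSwap) {x : α} (hx : σ x ≠ x) :
    σ = swap x (σ x) := by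
  obtain ⟨a, b, hab, rfl⟩ := hσ
  by_cases ha : x = a
  · rw [ha, swap_apply_left]
  by_cases hb : x = b
  · rw [hb, swap_apply_right, swap_comm]
  exact absurd (swap_apply_of_ne_of_ne ha hb) hx

/-- If `σ` has at least two 2-cycles, a fixed point is excluded by the 5-cycle construction. Without
fixed points, exactly two 2-cycles contradict the sign, exactly three give degree six, and four or
more are excluded by the 4-cycle construction. -/
theorem Equiv.Perm.isSwap_of_involution [Fintype α] (h6 : Fintype.card α ≠ 6) (σ : Perm α)
    (hσ : σ * σ = 1) (hsign : sign σ = -1)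
    (hconj : ∀ δ : Perm α, (σ * (δ * σ * δ⁻¹)) ^ 6 = 1) : σ.IsSwap := by
  have hinv : ∀ x, σ (σ x) = x := fun x => by rw [← mul_apply, hσ, one_apply]
  have hinj : ∀ x y, σ x = σ y → x = y := fun x y h => σ.injective h
  obtain ⟨a, ha⟩ : ∃ a, σ a ≠ a := by
    by_contra! h
    have : σ = 1 := Equiv.ext h
    rw [this, map_one] at hsign
    exact absurd hsign (by decide)
  by_contra hns
  have two : ∀ x y, σ x ≠ x → y ≠ x → y ≠ σ x → σ y ≠ x ∧ σ y ≠ σ x := fun x y _ h1 h2 =>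
    ⟨fun h => h2 (by rw [← h, hinv]), fun h => h1 (hinj _ _ h)⟩
  obtain ⟨c, hca, hcb, hc⟩ : ∃ c, c ≠ a ∧ c ≠ σ a ∧ σ c ≠ c := by
    by_contra! h
    refine hns ⟨a, σ a, Ne.symm ha, Equiv.ext fun x => ?_⟩
    by_cases hxa : x = a
    · rw [hxa, swap_apply_left]
    by_cases hxb : x = σ a
    · rw [hxb, swap_apply_right, hinv]
    · rw [swap_apply_of_ne_of_ne hxa hxb, h x hxa hxb]
  obtain ⟨hda, hdb⟩ := two a c ha hca hcb
  have hfix : ∀ e, σ e ≠ e := by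
    intro e he
    obtain ⟨δ, hδ⟩ := exists_conj_of_two_cycles_of_fixed σ a (σ a) c (σ c) e
      (by
        have h1 : a ≠ e := fun h => ha (by rw [h, he])
        have h2 : σ a ≠ e := fun h => h1 (hinj _ _ (by rw [h, he]))
        have h3 : c ≠ e := fun h => hc (by rw [h, he])
        have h4 : σ c ≠ e := fun h => h3 (hinj _ _ (by rw [h, he]))
        simp [Ne.symm ha, Ne.symm hca, Ne.symm hcb, Ne.symm hc, Ne.symm hda, h1, h2, h3, h4])
      rfl (hinv a) rfl (hinv c) he
    exact hδ (hconj δ)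
  obtain ⟨e, hea, heb, hec, hed⟩ : ∃ e, e ≠ a ∧ e ≠ σ a ∧ e ≠ c ∧ e ≠ σ c := by
    by_contra! h
    have : σ = swap a (σ a) * swap c (σ c) := by
      ext x
      by_cases h1 : x = a
      · rw [h1, mul_apply, swap_apply_of_ne_of_ne (Ne.symm hca) (Ne.symm hda), swap_apply_left]
      by_cases h2 : x = σ a
      · rw [h2, mul_apply, swap_apply_of_ne_of_ne (Ne.symm hcb) (Ne.symm hdb), swap_apply_right,
          hinv]
      by_cases h3 : x = c
      · rw [h3, mul_apply, swap_apply_left, swap_apply_of_ne_of_ne hda hdb]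
      · rw [h x h1 h2 h3, mul_apply, swap_apply_right, swap_apply_of_ne_of_ne hca hcb, hinv]
    rw [this, map_mul, sign_swap (Ne.symm ha), sign_swap (Ne.symm hc)] at hsign
    exact absurd hsign (by decide)
  obtain ⟨hfa, hfb⟩ := two a e ha hea heb
  obtain ⟨hfc, hfd⟩ := two c e hc hec hed
  have he := hfix e
  by_cases h : ∃ g, g ≠ a ∧ g ≠ σ a ∧ g ≠ c ∧ g ≠ σ c ∧ g ≠ e ∧ g ≠ σ e
  · obtain ⟨g, hga, hgb, hgc, hgd, hge, hgf⟩ := h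
    obtain ⟨hh1, hh2⟩ := two a g ha hga hgb
    obtain ⟨hh3, hh4⟩ := two c g hc hgc hgd
    obtain ⟨hh5, hh6⟩ := two e g he hge hgf
    obtain ⟨δ, hδ⟩ := exists_conj_of_four_two_cycles σ a (σ a) c (σ c) e (σ e) g (σ g)
      (by
        simp [Ne.symm ha, Ne.symm hca, Ne.symm hcb, Ne.symm hc, Ne.symm hda, Ne.symm hea,
          Ne.symm heb, Ne.symm hec, Ne.symm hed, Ne.symm hfa, Ne.symm hfc,
          Ne.symm he, Ne.symm hga, Ne.symm hgb, Ne.symm hgc, Ne.symm hgd, Ne.symm hge,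
          Ne.symm hgf, Ne.symm hh1, Ne.symm hh3, Ne.symm hh5, Ne.symm (hfix g)])
      rfl (hinv a) rfl (hinv c) rfl (hinv e) rfl (hinv g)
    exact hδ (hconj δ)
  · push Not at h
    have huniv : (Finset.univ : Finset α) = {a, σ a, c, σ c, e, σ e} := by
      ext x
      simp only [Finset.mem_univ, Finset.mem_insert, Finset.mem_singleton, true_iff]
      by_contra hx
      push Not at hx
      exact hx.2.2.2.2.2 (h x hx.1 hx.2.1 hx.2.2.1 hx.2.2.2.1 hx.2.2.2.2.1)
    apply h6
    rw [← Finset.card_univ, huniv]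
    have hn : [a, σ a, c, σ c, e, σ e].Nodup := by
      simp [Ne.symm ha, Ne.symm hca, Ne.symm hcb, Ne.symm hc, Ne.symm hda, Ne.symm hea,
        Ne.symm heb, Ne.symm hec, Ne.symm hed, Ne.symm hfa, Ne.symm hfc, Ne.symm he]
    simpa only [List.toFinset_cons, List.toFinset_nil, insert_empty_eq, List.length_cons,
      List.length_nil] using List.toFinset_card_of_nodup hn

theorem Equiv.Perm.IsSwap.exists_apply_ne_of_not_commute {s t : Perm α} (hs : s.IsSwap)
    (hst : ¬ Commute s t) : ∃ a, s a ≠ a ∧ t a ≠ a := by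
  obtain ⟨p, q, hpq, rfl⟩ := hs
  by_contra! h
  refine hst (Commute.symm ?_)
  have h1 := h p (by rw [swap_apply_left]; exact Ne.symm hpq)
  have h2 := h q (by rw [swap_apply_right]; exact hpq)
  have h3 := mul_swap_eq_swap_mul t p q
  rwa [h1, h2] at h3

/-- The transpositions through `o` pairwise fail to commute, so the images of two of them share a
point `a`; injectivity puts `a` in all the other images. The conjugator sends `o` to `a` and `j` to
the partner of `a` in the image of `swap o j`. -/
theorem Equiv.Perm.exists_eq_conj_of_map_isSwap [Fintype α] (hcard : 4 ≤ Fintype.card α)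
    (f : Perm α →* Perm α) (hf : Function.Injective f)
    (hswap : ∀ i j, i ≠ j → (f (swap i j)).IsSwap) :
    ∃ γ : Perm α, ∀ σ, f σ = γ * σ * γ⁻¹ := by
  obtain ⟨o⟩ : Nonempty α := Fintype.card_pos_iff.1 (by omega)
  have hnc : ∀ i j, i ≠ o → j ≠ o → i ≠ j → ¬ Commute (f (swap o i)) (f (swap o j)) := by
    intro i j hi hj hij hc
    have h1 : swap o i * swap o j = swap o j * swap o i := hf (by rw [map_mul, map_mul, hc.eq])
    rw [mul_swap_eq_swap_mul, swap_apply_left, swap_apply_of_ne_of_ne hj (Ne.symm hij)] at h1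
    have h2 := congrArg (fun τ : Perm α => τ o) (mul_right_cancel h1)
    simp only [swap_apply_left, swap_apply_of_ne_of_ne (Ne.symm hi) (Ne.symm hj)] at h2
    exact hj h2.symm
  obtain ⟨j₁, hj1⟩ : ∃ j, j ∉ ({o} : Finset α) := by
    by_contra! h
    have := Finset.card_le_card (fun x _ => h x : (Finset.univ : Finset α) ⊆ {o})
    rw [Finset.card_univ, Finset.card_singleton] at this
    omega
  obtain ⟨j₂, hj2⟩ : ∃ j, j ∉ ({o, j₁} : Finset α) := by
    by_contra! h
    have := Finset.card_le_card (fun x _ => h x : (Finset.univ : Finset α) ⊆ {o, j₁})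
    have h2 := Finset.card_le_two (a := o) (b := j₁)
    rw [Finset.card_univ] at this
    omega
  simp only [Finset.mem_insert, Finset.mem_singleton, not_or] at hj1 hj2
  have hs1 := hswap o j₁ (Ne.symm hj1)
  have hs2 := hswap o j₂ (Ne.symm hj2.1)
  obtain ⟨a, ha1, ha2⟩ := hs1.exists_apply_ne_of_not_commute (hnc _ _ hj1 hj2.1 (Ne.symm hj2.2))
  have e1 := hs1.eq_swap_apply ha1
  have e2 := hs2.eq_swap_apply ha2
  set s₁ := f (swap o j₁) with hs₁
  set s₂ := f (swap o j₂) with hs₂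
  -- A third image avoiding `a` would meet both `s₁` and `s₂`, hence be `swap (s₁ a) (s₂ a) = s₁ *
  -- s₂ * s₁⁻¹`. That is the image of `swap j₁ j₂`, which fixes `o`, contradicting injectivity.
  have hmove : ∀ j, j ≠ o → f (swap o j) a ≠ a := by
    intro j hj h
    have hs3 := hswap o j (Ne.symm hj)
    by_cases hjj1 : j = j₁
    · rw [hjj1] at h; exact ha1 h
    by_cases hjj2 : j = j₂
    · rw [hjj2] at h; exact ha2 h
    have hb : f (swap o j) (s₁ a) ≠ s₁ a := by
      intro hb
      have h3 := mul_swap_eq_swap_mul (f (swap o j)) a (s₁ a)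
      rw [h, hb, ← e1] at h3
      exact hnc j j₁ hj hj1 hjj1 h3
    have hc : f (swap o j) (s₂ a) ≠ s₂ a := by
      intro hc
      have h3 := mul_swap_eq_swap_mul (f (swap o j)) a (s₂ a)
      rw [h, hc, ← e2] at h3
      exact hnc j j₂ hj hj2.1 hjj2 h3
    have hbc : s₁ a ≠ s₂ a := by
      intro hbc
      refine hnc j₁ j₂ hj1 hj2.1 (Ne.symm hj2.2) ?_
      change Commute s₁ s₂
      rw [e1, e2, hbc]
    have e3 := hs3.eq_swap_apply hb
    have hcb : f (swap o j) (s₁ a) = s₂ a := by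
      by_contra hne
      rw [e3] at hc
      exact hc (swap_apply_of_ne_of_ne (Ne.symm hbc) (Ne.symm hne))
    rw [hcb] at e3
    have h4 : s₁ * s₂ * s₁⁻¹ = f (swap o j) := by
      have h5 := conj_swap_eq s₁ a (s₂ a)
      rw [← e2, (DFunLike.congr_fun e1 (s₂ a)).trans
        (swap_apply_of_ne_of_ne ha2 (Ne.symm hbc))] at h5
      rw [e3, h5]
    rw [hs₁, hs₂, ← map_inv, ← map_mul, ← map_mul, conj_swap_eq, swap_apply_left,
      swap_apply_of_ne_of_ne hj2.1 hj2.2] at h4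
    have h5 := congrArg (fun τ : Perm α => τ o) (hf h4)
    simp only [swap_apply_left, swap_apply_of_ne_of_ne (Ne.symm hj1) (Ne.symm hj2.1)] at h5
    exact hj h5.symm
  let g : α → α := fun j => if j = o then a else f (swap o j) a
  have hgo : g o = a := if_pos rfl
  have hg : ∀ j, j ≠ o → g j = f (swap o j) a := fun j hj => if_neg hj
  have hginj : Function.Injective g := by
    intro i j hij
    by_cases hi : i = o
    · by_cases hj : j = o
      · rw [hi, hj]
      · rw [hi, hgo, hg j hj] at hij
        exact absurd hij.symm (hmove j hj)
    · by_cases hj : j = o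
      · rw [hj, hgo, hg i hi] at hij
        exact absurd hij (hmove i hi)
      · rw [hg i hi, hg j hj] at hij
        have h1 := (hswap o i (Ne.symm hi)).eq_swap_apply (hmove i hi)
        rw [hij, ← (hswap o j (Ne.symm hj)).eq_swap_apply (hmove j hj)] at h1
        have h2 := congrArg (fun τ : Perm α => τ o) (hf h1)
        simpa using h2
  let γ : Perm α := Equiv.ofBijective g (Finite.injective_iff_bijective.1 hginj)
  have hγ : ∀ j, γ j = g j := fun _ => rfl
  have hstar : ∀ j, f (swap o j) = γ * swap o j * γ⁻¹ := by
    intro j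
    rw [conj_swap_eq, hγ, hγ, hgo]
    by_cases hj : j = o
    · rw [hj, hgo, swap_self, swap_self]; exact map_one f
    · rw [hg j hj]
      exact (hswap o j (Ne.symm hj)).eq_swap_apply (hmove j hj)
  refine ⟨γ, fun σ => ?_⟩
  induction σ using swap_induction_on with
  | one => rw [map_one]; group
  | swap_mul σ i j hij ih =>
    have h1 : f (swap i j) = γ * swap i j * γ⁻¹ := by
      by_cases hi : i = o
      · rw [hi]; exact hstar j
      by_cases hj : j = o
      · rw [hj, swap_comm]; exact hstar i
      have h2 : swap o i * swap o j * (swap o i)⁻¹ = swap i j := by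
        rw [conj_swap_eq, swap_apply_left, swap_apply_of_ne_of_ne hj (Ne.symm hij)]
      rw [← h2, map_mul, map_mul, map_inv, hstar, hstar]
      group
    rw [map_mul, h1, ih]
    group

/-- Every automorphism of a symmetric group of degree at least four and different from six is
inner. -/
theorem Equiv.Perm.exists_eq_conj_of_injective [Fintype α] (hcard : 4 ≤ Fintype.card α)
    (h6 : Fintype.card α ≠ 6) (f : Perm α →* Perm α) (hf : Function.Injective f) :
    ∃ γ : Perm α, ∀ σ, f σ = γ * σ * γ⁻¹ := by
  have hsurj : Function.Surjective f := Finite.surjective_of_injective hf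
  have : Nontrivial α := Fintype.one_lt_card_iff_nontrivial.1 (by omega)
  have hsign : ∀ σ, sign (f σ) = sign σ := by
    intro σ
    have := eq_sign_of_surjective_hom (s := (sign (α := α)).comp f) ((sign_surjective α).comp hsurj)
    exact DFunLike.congr_fun this σ
  refine exists_eq_conj_of_map_isSwap hcard f hf fun i j hij => ?_
  refine isSwap_of_involution h6 _ ?_ ?_ fun δ => ?_
  · rw [← map_mul, swap_mul_self, map_one]
  · rw [hsign, sign_swap hij]
  -- By surjectivity every such product is the image of a product of two transpositions, whose order
  -- divides six.
  · obtain ⟨ε, rfl⟩ := hsurj δ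
    rw [← map_inv, ← map_mul, ← map_mul, ← map_mul, ← map_pow, conj_swap_eq,
      swap_mul_swap_pow_six, map_one]

end automorphisms

/-! ### Eigenvectors and the commutant -/

section eigen

theorem exists_unit_smul {n : ℕ} {w : Fin n → ℝ} (hw : w ≠ 0) :
    ∃ c : ℝ, (c • w) ⬝ᵥ (c • w) = 1 := by
  have hpos : 0 < w ⬝ᵥ w := by
    refine lt_of_le_of_ne ?_ fun h => hw (dotProduct_self_eq_zero.1 h.symm)
    exact Finset.sum_nonneg fun i _ => mul_self_nonneg _
  refine ⟨(√(w ⬝ᵥ w))⁻¹, ?_⟩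
  rw [smul_dotProduct, dotProduct_smul, smul_eq_mul, smul_eq_mul, ← mul_assoc, ← mul_inv,
    Real.mul_self_sqrt hpos.le, inv_mul_cancel₀ hpos.ne']

theorem character_orthRep {Γ : Type*} [Group Γ] {n : ℕ}
    (ρ : Γ →* Matrix.orthogonalGroup (Fin n) ℝ) (γ : Γ) :
    (orthRep ρ).character γ = (ρ γ : Matrix (Fin n) (Fin n) ℝ).trace := by
  change LinearMap.trace ℝ _ (Matrix.toLin' (ρ γ : Matrix (Fin n) (Fin n) ℝ)) = _
  exact Matrix.trace_toLin'_eq _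

/-- The alternating sum `T` of the powers of `A = ρ z` satisfies `A * T = -T`, as the order is even.
Its trace is the order times `multNegOne ρ z`, so `T ≠ 0`, and any nonzero `T w` is a
`-1`-eigenvector. -/
theorem exists_neg_eigenvector {Γ : Type*} [Group Γ] {n : ℕ}
    (ρ : Γ →* Matrix.orthogonalGroup (Fin n) ℝ) (z : Γ) (heven : Even (orderOf z))
    (hz : 0 < multNegOne ρ z) :
    ∃ v : Fin n → ℝ, v ⬝ᵥ v = 1 ∧ Matrix.mulVec (ρ z : Matrix (Fin n) (Fin n) ℝ) v = -v := by
  let A : Matrix (Fin n) (Fin n) ℝ := ρ z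
  have hpow : ∀ k, ((ρ (z ^ k) : Matrix.orthogonalGroup (Fin n) ℝ) : Matrix (Fin n) (Fin n) ℝ) =
      A ^ k := fun k => by rw [map_pow]; rfl
  let T : Matrix (Fin n) (Fin n) ℝ := ∑ k ∈ Finset.range (orderOf z), (-1 : ℝ) ^ k • A ^ k
  have htr : multNegOne ρ z = (1 / (orderOf z : ℝ)) * T.trace := by
    rw [multNegOne, Matrix.trace_sum]
    congr 1
    refine Finset.sum_congr rfl fun k _ => ?_
    rw [character_orthRep, hpow, Matrix.trace_smul, smul_eq_mul]
  have hT : T ≠ 0 := by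
    intro h
    rw [htr, h, Matrix.trace_zero, mul_zero] at hz
    exact lt_irrefl _ hz
  have hAT : A * T = -T := by
    have h1 : A * T = -∑ k ∈ Finset.range (orderOf z), (-1 : ℝ) ^ (k + 1) • A ^ (k + 1) := by
      rw [Finset.mul_sum, ← Finset.sum_neg_distrib]
      refine Finset.sum_congr rfl fun k _ => ?_
      rw [Matrix.mul_smul, ← pow_succ', pow_succ (-1 : ℝ), mul_neg_one, neg_smul, neg_neg]
    have h2 := Finset.sum_range_succ' (fun k => (-1 : ℝ) ^ k • A ^ k) (orderOf z)
    rw [Finset.sum_range_succ, heven.neg_one_pow, ← hpow, pow_orderOf_eq_one, map_one, pow_zero,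
      pow_zero] at h2
    rw [h1, ← add_right_cancel h2]
  obtain ⟨w, hw⟩ : ∃ w, Matrix.mulVec T w ≠ 0 := by
    by_contra! h
    exact hT (Matrix.ext_of_mulVec_single fun i => by rw [h, Matrix.zero_mulVec])
  obtain ⟨c, hc⟩ := exists_unit_smul hw
  refine ⟨_, hc, ?_⟩
  change Matrix.mulVec A _ = _
  rw [Matrix.mulVec_smul, Matrix.mulVec_mulVec, hAT, Matrix.neg_mulVec, smul_neg]

theorem nonempty_of_isIrreducible {Γ : Type*} [Group Γ] {n : ℕ}
    {ρ : Γ →* Matrix.orthogonalGroup (Fin n) ℝ} (hirr : (orthRep ρ).IsIrreducible) :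
    Nonempty (Fin n) := by
  by_contra h
  rw [not_nonempty_iff] at h
  obtain ⟨V, W, hVW⟩ := hirr.toNontrivial
  refine hVW (SetLike.ext fun v => ?_)
  rw [Subsingleton.elim v 0]
  exact ⟨fun _ => W.toSubmodule.zero_mem, fun _ => V.toSubmodule.zero_mem⟩

/-- Since `gᵀ = g⁻¹`, the symmetric matrix `g + gᵀ` commutes with `ρ`. It has a real eigenvalue, and
the eigenspace is a nonzero subrepresentation, hence everything. -/
theorem exists_add_transpose_eq_smul {Γ : Type*} [Group Γ] {n : ℕ}
    {ρ : Γ →* Matrix.orthogonalGroup (Fin n) ℝ} (hirr : (orthRep ρ).IsIrreducible)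
    (g : Matrix.orthogonalGroup (Fin n) ℝ) (hg : ∀ γ, g * ρ γ = ρ γ * g) :
    ∃ c : ℝ, (g : Matrix (Fin n) (Fin n) ℝ) + (g : Matrix (Fin n) (Fin n) ℝ).transpose =
      (2 * c) • (1 : Matrix (Fin n) (Fin n) ℝ) := by
  obtain ⟨i⟩ := nonempty_of_isIrreducible hirr
  have hinv : ∀ h : Matrix.orthogonalGroup (Fin n) ℝ,
      ((h⁻¹ : Matrix.orthogonalGroup (Fin n) ℝ) : Matrix (Fin n) (Fin n) ℝ) =
        (h : Matrix (Fin n) (Fin n) ℝ).transpose := fun h => rfl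
  set S : Matrix (Fin n) (Fin n) ℝ := (g : Matrix (Fin n) (Fin n) ℝ) +
    (g : Matrix (Fin n) (Fin n) ℝ).transpose with hS
  have hH : S.IsHermitian := by
    rw [Matrix.IsHermitian, Matrix.conjTranspose_eq_transpose_of_trivial, hS,
      Matrix.transpose_add, Matrix.transpose_transpose, add_comm]
  have hcomm : ∀ γ, S * (ρ γ : Matrix (Fin n) (Fin n) ℝ) = (ρ γ : Matrix (Fin n) (Fin n) ℝ) * S := by
    intro γ
    have h1 : (g : Matrix (Fin n) (Fin n) ℝ) * (ρ γ : Matrix (Fin n) (Fin n) ℝ) =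
        (ρ γ : Matrix (Fin n) (Fin n) ℝ) * (g : Matrix (Fin n) (Fin n) ℝ) :=
      congrArg Subtype.val (hg γ)
    have h2 : ((g⁻¹ : Matrix.orthogonalGroup (Fin n) ℝ) : Matrix (Fin n) (Fin n) ℝ) *
        (ρ γ : Matrix (Fin n) (Fin n) ℝ) = (ρ γ : Matrix (Fin n) (Fin n) ℝ) *
        ((g⁻¹ : Matrix.orthogonalGroup (Fin n) ℝ) : Matrix (Fin n) (Fin n) ℝ) :=
      congrArg Subtype.val (show Commute g (ρ γ) from hg γ).inv_left.eq
    rw [hinv] at h2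
    rw [hS, add_mul, mul_add, h1, h2]
  let V : Subrepresentation (orthRep ρ) :=
    { toSubmodule := LinearMap.ker (Matrix.toLin' S - hH.eigenvalues i • LinearMap.id)
      apply_mem_toSubmodule := fun γ v hv => by
        rw [LinearMap.mem_ker, LinearMap.sub_apply, sub_eq_zero] at hv ⊢
        change Matrix.mulVec S v = hH.eigenvalues i • v at hv
        change Matrix.mulVec S (Matrix.mulVec (ρ γ : Matrix (Fin n) (Fin n) ℝ) v) =
          hH.eigenvalues i • Matrix.mulVec (ρ γ : Matrix (Fin n) (Fin n) ℝ) v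
        rw [Matrix.mulVec_mulVec, hcomm, ← Matrix.mulVec_mulVec, hv, Matrix.mulVec_smul] }
  have hu : (hH.eigenvectorBasis i).ofLp ∈ V := by
    change (hH.eigenvectorBasis i).ofLp ∈
      LinearMap.ker (Matrix.toLin' S - hH.eigenvalues i • LinearMap.id)
    rw [LinearMap.mem_ker, LinearMap.sub_apply, sub_eq_zero]
    exact hH.mulVec_eigenvectorBasis i
  have hne : (hH.eigenvectorBasis i).ofLp ≠ 0 := fun h =>
    hH.eigenvectorBasis.orthonormal.ne_zero i (by ext j; exact congrFun h j)
  have htop : V = ⊤ := (hirr.eq_bot_or_eq_top V).resolve_left fun h => by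
    rw [h] at hu
    exact hne hu
  refine ⟨hH.eigenvalues i / 2, Matrix.ext_of_mulVec_single fun j => ?_⟩
  have hj : (Pi.single j 1 : Fin n → ℝ) ∈ V := by rw [htop]; trivial
  change _ ∈ LinearMap.ker (Matrix.toLin' S - hH.eigenvalues i • LinearMap.id) at hj
  rw [LinearMap.mem_ker, LinearMap.sub_apply, sub_eq_zero] at hj
  change Matrix.mulVec S _ = hH.eigenvalues i • _ at hj
  rw [hj, Matrix.smul_mulVec, Matrix.one_mulVec, mul_div_cancel₀ _ two_ne_zero]
  rfl

/-- An orthogonal matrix commuting with an irreducible orthogonal representation is either `-1`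
or the square of another such matrix. -/
theorem eq_neg_one_or_exists_sq {Γ : Type*} [Group Γ] {n : ℕ}
    {ρ : Γ →* Matrix.orthogonalGroup (Fin n) ℝ} (hirr : (orthRep ρ).IsIrreducible)
    (g : Matrix.orthogonalGroup (Fin n) ℝ) (hg : ∀ γ, g * ρ γ = ρ γ * g) :
    (g : Matrix (Fin n) (Fin n) ℝ) = -1 ∨
      ∃ h : Matrix.orthogonalGroup (Fin n) ℝ, h * h = g ∧ ∀ γ, h * ρ γ = ρ γ * h := by
  obtain ⟨c, hc⟩ := exists_add_transpose_eq_smul hirr g hg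
  set B : Matrix (Fin n) (Fin n) ℝ := (g : Matrix (Fin n) (Fin n) ℝ) with hB
  have hgg : B.transpose * B = 1 := (Matrix.mem_orthogonalGroup_iff' _ _).1 g.2
  -- Besides this identity one has `(1 + B)² = (2 + 2c) B`. If `2 + 2c ≤ 0` then `1 + B = 0`;
  -- otherwise `(1 + B) / √(2 + 2c)` is the required square root.
  have hK : (1 + B).transpose * (1 + B) = (2 + 2 * c) • (1 : Matrix (Fin n) (Fin n) ℝ) := by
    have : (1 + B).transpose * (1 + B) = 1 + (B + B.transpose) + B.transpose * B := by
      rw [Matrix.transpose_add, Matrix.transpose_one]; noncomm_ring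
    rw [this, hc, hgg, add_smul, two_smul]; abel
  have hBB : B * B = (2 * c) • B - 1 := by
    have h1 : (B + B.transpose) * B = (2 * c) • B := by rw [hc, Matrix.smul_mul, one_mul]
    rw [add_mul, hgg] at h1
    rw [← h1, add_sub_cancel_right]
  rcases le_or_gt (2 + 2 * c) 0 with hc0 | hc0
  · left
    have h0 : 1 + B = 0 := Matrix.ext_of_mulVec_single fun j => by
      rw [Matrix.zero_mulVec, ← dotProduct_self_eq_zero, Matrix.dotProduct_mulVec,
        ← Matrix.mulVec_transpose, Matrix.mulVec_mulVec, hK, Matrix.smul_mulVec,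
        Matrix.one_mulVec, smul_dotProduct]
      have h1 : (0 : ℝ) ≤ (Matrix.mulVec (1 + B) (Pi.single j 1)) ⬝ᵥ
          (Matrix.mulVec (1 + B) (Pi.single j 1)) :=
        Finset.sum_nonneg fun i _ => mul_self_nonneg _
      rw [Matrix.dotProduct_mulVec, ← Matrix.mulVec_transpose, Matrix.mulVec_mulVec, hK,
        Matrix.smul_mulVec, Matrix.one_mulVec, smul_dotProduct] at h1
      have h2 : (Pi.single j 1 : Fin n → ℝ) ⬝ᵥ Pi.single j 1 = 1 := by simp
      rw [h2, smul_eq_mul, mul_one] at h1 ⊢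
      exact le_antisymm hc0 h1
    rw [add_comm] at h0
    exact eq_neg_of_add_eq_zero_left h0
  · right
    set r : ℝ := (√(2 + 2 * c))⁻¹ with hr
    have hrr : r * r * (2 + 2 * c) = 1 := by
      rw [hr, ← mul_inv, Real.mul_self_sqrt hc0.le, inv_mul_cancel₀ hc0.ne']
    refine ⟨⟨r • (1 + B), ?_⟩, Subtype.ext ?_, fun γ => Subtype.ext ?_⟩
    · rw [Matrix.mem_orthogonalGroup_iff', Matrix.transpose_smul, Matrix.smul_mul, Matrix.mul_smul,
        hK, smul_smul, smul_smul, hrr, one_smul]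
    · change (r • (1 + B)) * (r • (1 + B)) = B
      rw [Matrix.smul_mul, Matrix.mul_smul, smul_smul]
      have : (1 + B) * (1 + B) = (2 + 2 * c) • B := by
        have h1 : (1 + B) * (1 + B) = 1 + B + B + B * B := by noncomm_ring
        rw [h1, hBB, add_smul, two_smul]; abel
      rw [this, smul_smul, hrr, one_smul]
    · have h1 : B * (ρ γ : Matrix (Fin n) (Fin n) ℝ) = (ρ γ : Matrix (Fin n) (Fin n) ℝ) * B :=
        congrArg Subtype.val (hg γ)
      change (r • (1 + B)) * (ρ γ : Matrix (Fin n) (Fin n) ℝ) =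
        (ρ γ : Matrix (Fin n) (Fin n) ℝ) * (r • (1 + B))
      rw [Matrix.smul_mul, Matrix.mul_smul, add_mul, mul_add, h1, one_mul, mul_one]

end eigen

/-! ### Conjugation in the Clifford algebra -/

section conjugation

open CliffordAlgebra

/-- Passing a vector through `x` costs a sign and replaces `x` by its involute. Two passes undo both
changes. -/
theorem mul_eq_mul_of_pinLin_eq_neg {n : ℕ} (x : PinG n) (hx : ∀ v, pinLin x v = -v)
    (b : CliffordAlgebra (negForm n)) (hb : b ∈ evenOdd (negForm n) 0) :
    (x : CliffordAlgebra (negForm n)) * b = b * x := by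
  have h1 : ∀ v, involute (x : CliffordAlgebra (negForm n)) * ι (negForm n) v =
      -(ι (negForm n) v * x) := fun v => by rw [involute_mul_ι, hx, map_neg, neg_mul]
  have h2 : ∀ v, (x : CliffordAlgebra (negForm n)) * ι (negForm n) v =
      -(ι (negForm n) v * involute (x : CliffordAlgebra (negForm n))) := fun v => by
    have h := congrArg involute (h1 v)
    simp only [map_mul, map_neg, involute_involute, involute_ι, mul_neg, neg_mul, neg_neg] at h
    rw [← h, neg_neg]
  induction b, hb using even_induction with
  | algebraMap r => exact (Algebra.commutes r _).symm
  | add _ _ _ _ ihu ihv => rw [mul_add, add_mul, ihu, ihv]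
  | ι_mul_ι_mul m₁ m₂ _ _ ih =>
    rw [mul_assoc (ι _ m₁), ← mul_assoc, h2, neg_mul, mul_assoc (ι _ m₁), ← mul_assoc (involute _),
      h1, mul_assoc, mul_assoc, ← ih]
    noncomm_ring

theorem ι_mul_neg_eq_of_pinLin {n : ℕ} (a : SpinG n) (v : Fin n → ℝ)
    (hv : pinLin (spinToPin n a) v = -v) :
    ι (negForm n) v * -(a : CliffordAlgebra (negForm n)) =
      (a : CliffordAlgebra (negForm n)) * ι (negForm n) v := by
  have h := involute_mul_ι (spinToPin n a) v
  rw [coe_spinToPin, spinGroup.involute_eq a.2, hv, map_neg] at h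
  rw [h]
  noncomm_ring

theorem spin_mem_evenOdd {n : ℕ} (a : SpinG n) :
    (a : CliffordAlgebra (negForm n)) ∈ evenOdd (negForm n) 0 :=
  spinGroup.mem_even a.2

/-- The product of the vectors of the standard basis. -/
def volumePin (n : ℕ) : PinG n :=
  orthoProd (fun i => Pi.single i 1) (fun i => by simp) (List.finRange n)

theorem pinLin_volumePin (n : ℕ) (v : Fin n → ℝ) : pinLin (volumePin n) v = -v := by
  have h : pinLin (volumePin n) = -LinearMap.id := by
    refine LinearMap.pi_ext' fun i => LinearMap.ext_ring ?_
    have := pinLin_orthoProd (fun i : Fin n => Pi.single i (1 : ℝ)) (fun i => by simp)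
      (fun i j hij => by simp [hij]) (List.finRange n) (List.nodup_finRange n) i
    rw [if_pos (List.mem_finRange i)] at this
    exact this
  rw [h]
  rfl

/-- The witness is `v` times the volume element, which is even because `n` is odd. The volume
element commutes with `a`, while `v` anticommutes with it. -/
theorem exists_spin_neg_conj {n : ℕ} (hn : Odd n) (a : SpinG n) (v : Fin n → ℝ)
    (hv1 : v ⬝ᵥ v = 1) (hv : pinLin (spinToPin n a) v = -v) :
    ∃ x : SpinG n, (x : CliffordAlgebra (negForm n)) * -(a : CliffordAlgebra (negForm n)) =
      a * x := by
  refine ⟨⟨(unitPin v hv1 * volumePin n : PinG n), (unitPin v hv1 * volumePin n).2, ?_⟩, ?_⟩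
  · have h1 := coe_orthoProd_mem_evenOdd (fun i : Fin n => Pi.single i (1 : ℝ)) (fun i => by simp)
      (List.finRange n)
    have h2 := SetLike.mul_mem_graded (ι_mem_evenOdd_one (negForm n) v) h1
    have h3 : (1 : ZMod 2) + ((List.finRange n).length : ZMod 2) = 0 := by
      rw [List.length_finRange, ← Nat.cast_one, ← Nat.cast_add, ZMod.natCast_eq_zero_iff]
      exact (Odd.add_odd odd_one hn).two_dvd
    rw [h3] at h2
    exact h2
  · change ι (negForm n) v * (volumePin n : CliffordAlgebra (negForm n)) * -_ =
      _ * (ι (negForm n) v * (volumePin n : CliffordAlgebra (negForm n)))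
    rw [mul_assoc, mul_eq_mul_of_pinLin_eq_neg _ (pinLin_volumePin n) _
      (neg_mem (spin_mem_evenOdd a)), ← mul_assoc, ι_mul_neg_eq_of_pinLin a v hv, mul_assoc]

/-- Lifts of commuting matrices commute up to a sign. If the image of `x` is a square in the
commutant, then `x = ±y²` and the sign cancels; if it is `-1`, then `x` commutes with all even
elements. -/
theorem coe_mul_comm_of_commute {Γ : Type*} [Group Γ] {n : ℕ}
    {ρ : Γ →* Matrix.orthogonalGroup (Fin n) ℝ} (hirr : (orthRep ρ).IsIrreducible)
    (x : PinG n) (hx : ∀ γ, pinCover n x * ρ γ = ρ γ * pinCover n x) (γ : Γ) (a : SpinG n)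
    (ha : spinCover n a = ρ γ) :
    (x : CliffordAlgebra (negForm n)) * a = a * x := by
  rcases eq_neg_one_or_exists_sq hirr _ hx with h | ⟨h, hh, hcomm⟩
  · refine mul_eq_mul_of_pinLin_eq_neg x (fun v => ?_) _ (spin_mem_evenOdd a)
    rw [← pinCover_mulVec, h, Matrix.neg_mulVec, Matrix.one_mulVec]
  · obtain ⟨y, rfl⟩ := exists_pinCover_eq h
    have h1 : pinCover n (y * spinToPin n a) = pinCover n (spinToPin n a * y) := by
      rw [map_mul, map_mul, ← spinCover_apply, ha, hcomm]
    have h2 : (y : CliffordAlgebra (negForm n)) * y * a = a * (y * y) := by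
      rcases coe_eq_or_neg_of_pinCover_eq h1 with h3 | h3 <;>
        rw [Submonoid.coe_mul, Submonoid.coe_mul, coe_spinToPin] at h3
      · rw [mul_assoc, h3, ← mul_assoc, h3, mul_assoc]
      · rw [mul_assoc, h3, mul_neg, ← mul_assoc, h3, neg_mul, neg_neg, mul_assoc]
    rw [← map_mul] at hh
    rcases coe_eq_or_neg_of_pinCover_eq hh with h3 | h3 <;> rw [Submonoid.coe_mul] at h3
    · rw [← h3, h2]
    · have h4 : (x : CliffordAlgebra (negForm n)) = -(y * y) := by rw [h3, neg_neg]
      rw [h4, neg_mul, h2, mul_neg]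

theorem spin_coe_ne_neg {n : ℕ} (a : SpinG n) :
    (a : CliffordAlgebra (negForm n)) ≠ -(a : CliffordAlgebra (negForm n)) := by
  intro h
  have h1 : (2 : ℝ) • (a : CliffordAlgebra (negForm n)) = 0 := by
    rw [two_smul]
    nth_rewrite 1 [h]
    exact neg_add_cancel _
  have h2 := spinGroup.coe_mul_star_self a
  rw [(smul_eq_zero.1 h1).resolve_left two_ne_zero, zero_mul, ← map_zero (algebraMap ℝ _),
    ← map_one (algebraMap ℝ _)] at h2
  exact zero_ne_one (cliffordAlgebraMap_injective n h2)

end conjugation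

/-! ### Lifting an orthogonal representation of a symmetric group -/

section lifting

open Equiv Equiv.Perm

theorem exists_negOneSpin {n : ℕ} [Nonempty (Fin n)] :
    ∃ z : SpinG n, (z : CliffordAlgebra (negForm n)) = -1 := by
  obtain ⟨i⟩ := ‹Nonempty (Fin n)›
  have hv : (Pi.single i 1 : Fin n → ℝ) ⬝ᵥ Pi.single i 1 = 1 := by simp
  exact ⟨⟨(unitPin _ hv * unitPin _ hv : PinG n), (unitPin _ hv * unitPin _ hv).2,
    CliffordAlgebra.ι_mul_ι_mem_evenOdd_zero _ _ _⟩, ι_mul_self_negForm hv⟩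

theorem eq_or_eq_mul_of_spinCover_eq {n : ℕ} {z : SpinG n}
    (hz : (z : CliffordAlgebra (negForm n)) = -1) {x y : SpinG n}
    (h : spinCover n x = spinCover n y) : x = y ∨ x = z * y := by
  rcases coe_eq_or_neg_of_pinCover_eq (x := spinToPin n x) (y := spinToPin n y) h with h | h
  · exact Or.inl (Subtype.ext h)
  · refine Or.inr (Subtype.ext ?_)
    rw [Submonoid.coe_mul, hz, neg_one_mul]
    exact h

theorem spinCover_eq_one {n : ℕ} {z : SpinG n}
    (hz : (z : CliffordAlgebra (negForm n)) = -1) : spinCover n z = 1 := by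
  refine Subtype.ext ?_
  change LinearMap.toMatrix' (pinLin (spinToPin n z)) = 1
  rw [← LinearMap.toMatrix'_id]
  congr 1
  refine LinearMap.ext fun v => cliffordι_injective n ?_
  rw [ι_pinLin, twistedAd_apply, coe_spinToPin, hz]
  simp

/-- A transposition has a spin lift of order dividing two, and so has a product of two disjoint
transpositions, if their characters are congruent to the degree modulo eight. Hence the
representation lifts. -/
theorem exists_spin_lift {m n : ℕ} (hm : 4 ≤ m)
    (ρ : Perm (Fin m) →* Matrix.orthogonalGroup (Fin n) ℝ)
    (hchar : ∀ x y : Perm (Fin m), x.IsSwap → y.IsSwap → x.Disjoint y →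
      (∃ a : ℤ, (orthRep ρ).character x = (n : ℝ) + 8 * (a : ℝ)) ∧
      (∃ b : ℤ, (orthRep ρ).character (x * y) = (n : ℝ) + 8 * (b : ℝ)))
    (z : SpinG n) (hz : (z : CliffordAlgebra (negForm n)) = -1) :
    ∃ φ : Perm (Fin m) →* SpinG n, (spinCover n).comp φ = ρ := by
  have : Nontrivial (Fin m) := Fin.nontrivial_iff_two_le.2 (by omega)
  have hzc : ∀ x : SpinG n, z * x = x * z := fun x => Subtype.ext (by
    rw [Submonoid.coe_mul, Submonoid.coe_mul, hz, neg_one_mul, mul_neg_one])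
  have hzz : z * z = 1 := Subtype.ext (by
    rw [Submonoid.coe_mul, hz, neg_mul_neg, one_mul]; rfl)
  have hdisj : ∀ i j k l : Fin m, i ≠ j → k ≠ l → i ≠ k → i ≠ l → j ≠ k → j ≠ l →
      (swap i j).Disjoint (swap k l) := by
    intro i j k l _ _ hik hil hjk hjl x
    by_cases hi : x = i
    · right; rw [hi]; exact swap_apply_of_ne_of_ne hik hil
    by_cases hj : x = j
    · right; rw [hj]; exact swap_apply_of_ne_of_ne hjk hjl
    · left; exact swap_apply_of_ne_of_ne hi hj
  have hsq : ∀ γ : Perm (Fin m), γ * γ = 1 →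
      (∃ a : ℤ, (orthRep ρ).character γ = (n : ℝ) + 8 * (a : ℝ)) →
      ∃ x : SpinG n, spinCover n x = ρ γ ∧ x * x = 1 := by
    rintro γ hγ ⟨a, ha⟩
    exact exists_spin_lift_of_involution (ρ γ) (by rw [← map_mul, hγ, map_one]) a
      (by rw [← character_orthRep, ha])
  have hall : ∀ γ : Perm (Fin m), γ * γ = 1 →
      (∃ a : ℤ, (orthRep ρ).character γ = (n : ℝ) + 8 * (a : ℝ)) →
      ∀ x : SpinG n, spinCover n x = ρ γ → x * x = 1 := by
    intro γ hγ ha x hx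
    obtain ⟨y, hy, hyy⟩ := hsq γ hγ ha
    rcases eq_or_eq_mul_of_spinCover_eq hz (hx.trans hy.symm) with h | h
    · rw [h, hyy]
    · rw [h, mul_assoc, ← mul_assoc y, ← hzc y, mul_assoc, ← mul_assoc z, hzz, one_mul, hyy]
  -- `hchar` speaks of disjoint pairs, so `4 ≤ m` is needed to provide a second transposition.
  have hswap : ∀ i j : Fin m, i ≠ j →
      ∃ a : ℤ, (orthRep ρ).character (swap i j) = (n : ℝ) + 8 * (a : ℝ) := by
    intro i j hij
    have hex : ∀ s : Finset (Fin m), s.card ≤ 3 → ∃ k, k ∉ s := fun s hs => by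
      by_contra! h
      have := Finset.card_le_card (fun x _ => h x : (Finset.univ : Finset (Fin m)) ⊆ s)
      rw [Finset.card_univ, Fintype.card_fin] at this
      omega
    obtain ⟨k, hk⟩ := hex {i, j} (Finset.card_le_two.trans (by omega))
    obtain ⟨l, hl⟩ := hex {i, j, k} Finset.card_le_three
    simp only [Finset.mem_insert, Finset.mem_singleton, not_or] at hk hl
    exact (hchar _ _ ⟨i, j, hij, rfl⟩ ⟨k, l, Ne.symm hl.2.2, rfl⟩
      (hdisj i j k l hij (Ne.symm hl.2.2) (Ne.symm hk.1) (Ne.symm hl.1) (Ne.symm hk.2)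
        (Ne.symm hl.2.1))).1
  refine exists_lift_of_swap_lifts (spinCover n) ρ z hzc
    (fun x y h => eq_or_eq_mul_of_spinCover_eq hz h) (fun i j hij => ?_) (fun i j x hij hx => ?_)
    fun i j k l x y hij hkl hik hil hjk hjl hx hy => ?_
  · obtain ⟨x, hx, -⟩ := hsq _ (swap_mul_self i j) (hswap i j hij)
    exact ⟨x, hx⟩
  · exact hall _ (swap_mul_self i j) (hswap i j hij) x hx
  · have hd := hdisj i j k l hij hkl hik hil hjk hjl
    have h1 := hall _ (swap_mul_self i j) (hswap i j hij) x hx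
    have h2 := hall _ (swap_mul_self k l) (hswap k l hkl) y hy
    have h3 : swap i j * swap k l * (swap i j * swap k l) = 1 := by
      rw [mul_assoc, ← mul_assoc (swap k l), ← hd.commute.eq, mul_assoc, swap_mul_self, mul_one,
        swap_mul_self]
    -- As `x`, `y` and `x * y` are all involutions, `x * y = (x * y)⁻¹ = y * x`.
    have h4 := hall _ h3 (hchar _ _ ⟨i, j, hij, rfl⟩ ⟨k, l, hkl, rfl⟩ hd).2 (x * y)
      (by rw [map_mul, map_mul, hx, hy])
    rw [eq_inv_of_mul_eq_one_left h4, mul_inv_rev, inv_eq_of_mul_eq_one_left h1,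
      inv_eq_of_mul_eq_one_left h2]

/-- The twist of a homomorphism into `Spin(n)` by the sign character. -/
theorem exists_sign_twist {m n : ℕ} (φ : Perm (Fin m) →* SpinG n) (z : SpinG n)
    (hz : (z : CliffordAlgebra (negForm n)) = -1) :
    ∃ ψ : Perm (Fin m) →* SpinG n, (spinCover n).comp ψ = (spinCover n).comp φ ∧
      ∀ γ, (ψ γ : CliffordAlgebra (negForm n)) =
        ((sign γ : ℤ) : ℝ) • (φ γ : CliffordAlgebra (negForm n)) := by
  have hzz : z * z = 1 := Subtype.ext (by
    rw [Submonoid.coe_mul, hz, neg_mul_neg, one_mul]; rfl)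
  have hzc : ∀ x : SpinG n, z * x = x * z := fun x => Subtype.ext (by
    rw [Submonoid.coe_mul, Submonoid.coe_mul, hz, neg_one_mul, mul_neg_one])
  have h11 : ¬ (-1 : ℤˣ) = 1 := by decide
  let s : ℤˣ →* SpinG n :=
    { toFun := fun u => if u = 1 then 1 else z
      map_one' := if_pos rfl
      map_mul' := fun u v => by
        rcases Int.units_eq_one_or u with rfl | rfl <;>
          rcases Int.units_eq_one_or v with rfl | rfl <;> simp [h11, hzz] }
  have hs1 : s (-1) = z := by
    change (if (-1 : ℤˣ) = 1 then 1 else z) = z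
    exact if_neg h11
  have hsc : ∀ u x, s u * x = x * s u := by
    intro u x
    rcases Int.units_eq_one_or u with rfl | rfl
    · rw [map_one, one_mul, mul_one]
    · rw [hs1, hzc]
  refine ⟨⟨⟨fun γ => s (sign γ) * φ γ, ?_⟩, fun γ δ => ?_⟩, MonoidHom.ext fun γ => ?_, fun γ => ?_⟩
  · rw [map_one, map_one, map_one, one_mul]
  · change s (sign (γ * δ)) * φ (γ * δ) = s (sign γ) * φ γ * (s (sign δ) * φ δ)
    rw [map_mul, map_mul, map_mul, mul_assoc, mul_assoc, ← mul_assoc (φ γ), ← hsc, mul_assoc]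
  · change spinCover n (s (sign γ) * φ γ) = spinCover n (φ γ)
    rw [map_mul]
    rcases Int.units_eq_one_or (sign γ) with h | h
    · rw [h, map_one, map_one, one_mul]
    · rw [h, hs1, spinCover_eq_one hz, one_mul]
  · change ((s (sign γ) * φ γ : SpinG n) : CliffordAlgebra (negForm n)) = _
    rcases Int.units_eq_one_or (sign γ) with h | h
    · rw [h, map_one, one_mul]; simp
    · rw [h, hs1, Submonoid.coe_mul, hz]; simp

end lifting

/-! ### Admissibility -/

section admissibility

open Equiv Equiv.Perm

variable {m n : ℕ} {ρ : Perm (Fin m) →* Matrix.orthogonalGroup (Fin n) ℝ}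
  {φ₁ φ₂ : Perm (Fin m) →* SpinG n}

/-- Working with `g` in Pin and with mere containment of images lets one argument serve both Spin
and Pin. -/
theorem not_exists_conj_into_range (hm : 4 ≤ m) (hm6 : m ≠ 6) (hfaithful : Function.Injective ρ)
    (hirr : (orthRep ρ).IsIrreducible) (h₁ : (spinCover n).comp φ₁ = ρ)
    (h₂ : (spinCover n).comp φ₂ = ρ)
    (htwist : ∀ γ, (φ₂ γ : CliffordAlgebra (negForm n)) =
      ((sign γ : ℤ) : ℝ) • (φ₁ γ : CliffordAlgebra (negForm n))) (g : PinG n)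
    (hg : ∀ γ, ∃ δ, g * spinToPin n (φ₁ γ) * g⁻¹ = spinToPin n (φ₂ δ)) : False := by
  have e1 : ∀ γ, spinCover n (φ₁ γ) = ρ γ := fun γ => DFunLike.congr_fun h₁ γ
  have e2 : ∀ γ, spinCover n (φ₂ γ) = ρ γ := fun γ => DFunLike.congr_fun h₂ γ
  have hinj1 : Function.Injective φ₁ := fun γ δ h => hfaithful (by rw [← e1, h, e1])
  have hinj2 : Function.Injective φ₂ := fun γ δ h => hfaithful (by rw [← e2, h, e2])
  choose f hf using hg
  let F : Perm (Fin m) →* Perm (Fin m) :=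
    { toFun := f
      map_one' := hinj2 (spinToPin_injective n (by
        rw [← hf, map_one, map_one, mul_one, mul_inv_cancel, map_one, map_one]))
      map_mul' := fun γ δ => hinj2 (spinToPin_injective n (by
        rw [← hf, map_mul, map_mul, map_mul, map_mul, ← hf, ← hf]; group)) }
  have hFinj : Function.Injective F := fun γ δ h => hinj1 (spinToPin_injective n (by
    have h1 := hf γ
    rw [show f γ = f δ from h, ← hf δ] at h1
    exact mul_left_cancel (mul_right_cancel h1)))
  obtain ⟨γ₀, hγ₀⟩ := exists_eq_conj_of_injective (by rw [Fintype.card_fin]; exact hm)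
    (by rw [Fintype.card_fin]; exact hm6) F hFinj
  -- This correction absorbs the inner automorphism by `γ₀`, so that `y` intertwines the two lifts
  -- pointwise.
  let y : PinG n := (spinToPin n (φ₂ γ₀))⁻¹ * g
  have hy : ∀ γ, y * spinToPin n (φ₁ γ) = spinToPin n (φ₂ γ) * y := by
    intro γ
    have h1 := hf γ
    rw [show f γ = γ₀ * γ * γ₀⁻¹ from hγ₀ γ, map_mul, map_mul, map_inv, map_mul, map_mul, map_inv,
      mul_inv_eq_iff_eq_mul] at h1
    change (spinToPin n (φ₂ γ₀))⁻¹ * g * _ = _ * ((spinToPin n (φ₂ γ₀))⁻¹ * g)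
    rw [mul_assoc, h1]
    group
  have hcomm : ∀ γ, pinCover n y * ρ γ = ρ γ * pinCover n y := by
    intro γ
    have h1 : pinCover n y * spinCover n (φ₁ γ) = spinCover n (φ₂ γ) * pinCover n y := by
      rw [spinCover_apply, spinCover_apply, ← map_mul, hy, map_mul]
    rwa [e1, e2] at h1
  let i₀ : Fin m := ⟨0, by omega⟩
  let i₁ : Fin m := ⟨1, by omega⟩
  have h01 : i₀ ≠ i₁ := by simp [i₀, i₁]
  let τ : Perm (Fin m) := swap i₀ i₁
  have h3 := coe_mul_comm_of_commute hirr y hcomm τ (φ₁ τ) (e1 τ)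
  have h4 := congrArg (fun w : PinG n => (w : CliffordAlgebra (negForm n))) (hy τ)
  simp only [Submonoid.coe_mul, coe_spinToPin] at h4
  rw [h3, htwist τ, sign_swap h01] at h4
  have h5 := congrArg (fun w => w * star (y : CliffordAlgebra (negForm n))) h4
  simp only [mul_assoc] at h5
  rw [← pinGroup.coe_star, pinGroup.coe_mul_star_self] at h5
  simp only [mul_one] at h5
  refine spin_coe_ne_neg (φ₁ τ) (h5.trans ?_)
  simp

theorem exists_neg_vector (hmult : ∀ z : Perm (Fin m), sign z = -1 → 0 < multNegOne ρ z)
    (h₁ : (spinCover n).comp φ₁ = ρ) (γ : Perm (Fin m)) (hγ : sign γ = -1) :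
    ∃ v : Fin n → ℝ, v ⬝ᵥ v = 1 ∧ pinLin (spinToPin n (φ₁ γ)) v = -v := by
  -- An odd permutation has even order, as its sign raised to the order is `1`.
  have heven : Even (orderOf γ) := by
    by_contra h
    rw [Nat.not_even_iff_odd] at h
    have h1 := congrArg sign (pow_orderOf_eq_one γ)
    rw [map_pow, hγ, h.neg_one_pow, map_one] at h1
    exact absurd h1 (by decide)
  obtain ⟨v, hv, hv2⟩ := exists_neg_eigenvector ρ γ heven (hmult γ hγ)
  refine ⟨v, hv, ?_⟩
  rw [← pinCover_mulVec, ← spinCover_apply, show spinCover n (φ₁ γ) = ρ γ from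
    DFunLike.congr_fun h₁ γ, hv2]

theorem admissible_spin (hn : Odd n) (hm : 4 ≤ m) (hm6 : m ≠ 6)
    (hfaithful : Function.Injective ρ) (hirr : (orthRep ρ).IsIrreducible)
    (hmult : ∀ z : Perm (Fin m), sign z = -1 → 0 < multNegOne ρ z)
    (h₁ : (spinCover n).comp φ₁ = ρ) (h₂ : (spinCover n).comp φ₂ = ρ)
    (htwist : ∀ γ, (φ₂ γ : CliffordAlgebra (negForm n)) =
      ((sign γ : ℤ) : ℝ) • (φ₁ γ : CliffordAlgebra (negForm n))) :
    Admissible φ₁ φ₂ := by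
  refine ⟨fun γ => ?_, ?_⟩
  · have ht := htwist γ
    rcases Int.units_eq_one_or (sign γ) with h | h
    · refine ⟨1, Subtype.ext ?_⟩
      rw [one_mul, inv_one, mul_one, ht, h]
      simp
    · obtain ⟨v, hv1, hv⟩ := exists_neg_vector hmult h₁ γ h
      obtain ⟨x, hx⟩ := exists_spin_neg_conj hn (φ₁ γ) v hv1 hv
      refine ⟨x, eq_mul_inv_of_mul_eq (Subtype.ext ?_)⟩
      rw [Submonoid.coe_mul, Submonoid.coe_mul, ht, h, ← hx]
      simp
  · rintro ⟨g, hg⟩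
    refine not_exists_conj_into_range hm hm6 hfaithful hirr h₁ h₂ htwist (spinToPin n g) fun γ => ?_
    have h : g * φ₁ γ * g⁻¹ ∈ φ₂.range := by
      rw [← hg]
      exact ⟨φ₁ γ, ⟨γ, rfl⟩, rfl⟩
    obtain ⟨δ, hδ⟩ := h
    exact ⟨δ, by rw [hδ, map_mul, map_mul, map_inv]⟩

theorem admissible_pin (hm : 4 ≤ m) (hm6 : m ≠ 6)
    (hfaithful : Function.Injective ρ) (hirr : (orthRep ρ).IsIrreducible)
    (hmult : ∀ z : Perm (Fin m), sign z = -1 → 0 < multNegOne ρ z)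
    (h₁ : (spinCover n).comp φ₁ = ρ) (h₂ : (spinCover n).comp φ₂ = ρ)
    (htwist : ∀ γ, (φ₂ γ : CliffordAlgebra (negForm n)) =
      ((sign γ : ℤ) : ℝ) • (φ₁ γ : CliffordAlgebra (negForm n))) :
    Admissible ((spinToPin n).comp φ₁) ((spinToPin n).comp φ₂) := by
  refine ⟨fun γ => ?_, ?_⟩
  · have ht := htwist γ
    rcases Int.units_eq_one_or (sign γ) with h | h
    · refine ⟨1, Subtype.ext ?_⟩
      rw [one_mul, inv_one, mul_one, MonoidHom.comp_apply, MonoidHom.comp_apply, coe_spinToPin,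
        coe_spinToPin, ht, h]
      simp
    · obtain ⟨v, hv1, hv⟩ := exists_neg_vector hmult h₁ γ h
      refine ⟨unitPin v hv1, eq_mul_inv_of_mul_eq (Subtype.ext ?_)⟩
      have hx := ι_mul_neg_eq_of_pinLin (φ₁ γ) v hv
      change (φ₁ γ : CliffordAlgebra (negForm n)) * CliffordAlgebra.ι (negForm n) v =
        CliffordAlgebra.ι (negForm n) v * (φ₂ γ : CliffordAlgebra (negForm n))
      rw [ht, h, ← hx]
      simp
  · rintro ⟨g, hg⟩
    refine not_exists_conj_into_range hm hm6 hfaithful hirr h₁ h₂ htwist g fun γ => ?_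
    have h : g * spinToPin n (φ₁ γ) * g⁻¹ ∈ ((spinToPin n).comp φ₂).range := by
      rw [← hg]
      exact ⟨spinToPin n (φ₁ γ), ⟨γ, rfl⟩, rfl⟩
    obtain ⟨δ, hδ⟩ := h
    exact ⟨δ, hδ.symm⟩

end admissibility

end

theorem mainTheorem2 (m n : ℕ) (hm : 4 ≤ m) (hm6 : m ≠ 6)
    (ρ : Equiv.Perm (Fin m) →* Matrix.orthogonalGroup (Fin n) ℝ)
    (hfaithful : Function.Injective ρ)
    (hirr : (orthRep ρ).IsIrreducible)
    (hchar : ∀ x y : Equiv.Perm (Fin m), x.IsSwap → y.IsSwap → x.Disjoint y →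
      (∃ a : ℤ, (orthRep ρ).character x = (n : ℝ) + 8 * (a : ℝ)) ∧
      (∃ b : ℤ, (orthRep ρ).character (x * y) = (n : ℝ) + 8 * (b : ℝ)))
    (hmult : ∀ z : Equiv.Perm (Fin m), Equiv.Perm.sign z = -1 → 0 < multNegOne ρ z) :
    (Odd n → ∃ φ₁ φ₂ : Equiv.Perm (Fin m) →* SpinG n,
      (spinCover n).comp φ₁ = ρ ∧ (spinCover n).comp φ₂ = ρ ∧
      (∀ γ : Equiv.Perm (Fin m), (φ₂ γ : CliffordAlgebra (negForm n)) =
        ((Equiv.Perm.sign γ : ℤ) : ℝ) • (φ₁ γ : CliffordAlgebra (negForm n))) ∧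
      Admissible φ₁ φ₂) ∧
    (∃ φ₁ φ₂ : Equiv.Perm (Fin m) →* PinG n,
      (pinCover n).comp φ₁ = ρ ∧ (pinCover n).comp φ₂ = ρ ∧
      (∀ γ : Equiv.Perm (Fin m), (φ₂ γ : CliffordAlgebra (negForm n)) =
        ((Equiv.Perm.sign γ : ℤ) : ℝ) • (φ₁ γ : CliffordAlgebra (negForm n))) ∧
      Admissible φ₁ φ₂) := by
  have := nonempty_of_isIrreducible hirr
  obtain ⟨z, hz⟩ := exists_negOneSpin (n := n)
  obtain ⟨φ₁, h₁⟩ := exists_spin_lift hm ρ hchar z hz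
  obtain ⟨φ₂, h₂, htwist⟩ := exists_sign_twist φ₁ z hz
  rw [h₁] at h₂
  refine ⟨fun hn => ⟨φ₁, φ₂, h₁, h₂, htwist, ?_⟩,
    (spinToPin n).comp φ₁, (spinToPin n).comp φ₂, h₁, h₂, htwist, ?_⟩
  · exact admissible_spin hn hm hm6 hfaithful hirr hmult h₁ h₂ htwist
  · exact admissible_pin hm hm6 hfaithful hirr hmult h₁ h₂ htwist
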